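/- Let $d\ge 1$ be an integer. For $f\in L^2(\mathbf R^d,\mathbf C)$ let $\mathcal F f$ be its Fourier transform, normalised so that $(\mathcal Ff)(k)=(2\pi)^{-d/2}\int e^{-ik\cdot x}f(x)\,dx$. For a real $n\ge 0$ let $H^n$ be the space of those $f\in L^2(\mathbf R^d,\mathbf C)$ with $\|f\|_n:=\big\|\sqrt{1+|k|^2}^{\,n}\,\mathcal Ff\big\|_{L^2}<\infty$. If $0\le n\le d/2<a$, let $K_{n,a,d}$ be the minimum constant $K$ such that, for all $f\in H^a$ and $g\in H^n$, $fg\in H^n$ and $\|fg\|_n\le K\,\|f\|_a\|g\|_n$. If $n\ge a>d/2$, let $K_{n,a,d}$ be the minimum constant $K$ such that, for all $f,g\in H^n$, $fg\in H^n$ and $\|fg\|_n\le K\max(\|f\|_a\|g\|_n,\|f\|_n\|g\|_a)$. Put $E(s):=s^s$ for $s>0$, $E(0):=1$, and for $a>d/2$, $0\le\ell\le a$, $$S_{a,d}:=\frac1{(4\pi)^{d/4}}\sqrt{\frac{\Gamma(a-d/2)}{\Gamma(a)}},\qquad E_{\ell,a,d}:=\left(\frac{E\big(\frac{\ell}{2a}\big)\,E\big(\frac12-\frac{\ell}{2a}\big)}{E\big(\frac12+\frac{\ell}{2a}\big)\,E\big(1-\frac{\ell}{2a}\big)}\right)^{d/2}.$$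 For real $n\ge0$ let $n_+:=\min\{m\in\mathbf N: m\ge n\}$, $\Lambda(n):=\{jn/n_+ : j=0,\dots,n_+\}$ (with $n/n_+:=1$ if $n=0$), and $\binom n\ell_+:=\binom{n_+}{j}$ for $\ell=jn/n_+\in\Lambda(n)$. If $0\le n\le d/2<a$, put $E_{n,\ell,a,d}:=E_{\ell,a,d}$; if $n\ge a>d/2$, put $$E_{n,\ell,a,d}:=\begin{cases}E_{\ell,a,d}&\text{if }0\le\ell<a/2,\\(16/27)^{d/4}&\text{if }a/2\le\ell\le n-a/2,\\E_{n-\ell,a,d}&\text{if }n-a/2<\ell\le n.\end{cases}$$ Finally, for $n\ge a>d/2$ put $$a_n:=\Big(\frac{n_+}{n}\,\frac a2\Big)_+,\qquad u_{n,a,d}:=1+\frac{(27/16)^{d/4}-1}{2^{\,n_+-a_n}}\binom{n_+}{n_+-a_n+1}.$$ **Proposition.** Let either $0\le n\le d/2<a$ or $n\ge a>d/2$. Then the minimum constant $K_{n,a,d}$ exists and $$K_{n,a,d}\le S_{a,d}\sum_{\ell\in\Lambda(n)}\binom n\ell_+E_{n,\ell,a,d}.$$ The right-hand side is at most $S_{a,d}\,2^{n_+}$,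 so that $K_{n,a,d}\le S_{a,d}\,2^{n_+}$. If $n\ge a>d/2$, the right-hand side is also at most $(16/27)^{d/4}S_{a,d}\,u_{n,a,d}\,2^{n_+}$, so that $$K_{n,a,d}\le(16/27)^{d/4}\,S_{a,d}\,u_{n,a,d}\,2^{n_+}.$$ Moreover $\lim_{n\to+\infty}u_{n,a,d}=1$ (along real $n$) for fixed $d$ and $a>d/2$. -/

import Mathlib

open MeasureTheory Filter Topology
open scoped FourierTransform ENNReal

namespace SobolevProduct

noncomputable section

/-- The space `ℝ^d` with its Euclidean norm. -/
abbrev Space (d : ℕ) : Type := EuclideanSpace ℝ (Fin d)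

/-- The Hilbert space `L²(ℝ^d, ℂ)`. -/
abbrev L2 (d : ℕ) : Type := Lp ℂ 2 (volume : Measure (Space d))

/-- The Fourier transform of an `L²` function, normalised as
`(ℱ f)(k) = (2π)^(-d/2) ∫ exp(-i k·x) f(x) dx`. Mathlib's transform `𝓕` has the kernel
`exp(-2πi ξ·x)` and no prefactor, so `(ℱ f)(k) = (2π)^(-d/2) (𝓕 f)(k / 2π)`. -/
def fourierL2 {d : ℕ} (f : L2 d) : Space d → ℂ := fun k =>
  (((2 * Real.pi) ^ (-(d : ℝ) / 2) : ℝ) : ℂ) * (𝓕 f : L2 d) ((2 * Real.pi)⁻¹ • k)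

/-- The function `k ↦ √(1 + |k|²)^n (ℱ f)(k)`. -/
def weightedFourier {d : ℕ} (n : ℝ) (f : L2 d) : Space d → ℂ := fun k =>
  ((Real.sqrt (1 + ‖k‖ ^ 2) ^ n : ℝ) : ℂ) * fourierL2 f k

/-- Membership in the Sobolev (Bessel potential) space `H^n(ℝ^d, ℂ)`, for order `n ≥ 0`;
for such `n` one has `H^n ⊆ L²`, so that all its elements are `L²` functions. -/
def MemH {d : ℕ} (n : ℝ) (f : L2 d) : Prop :=
  MemLp (weightedFourier n f) 2 (volume : Measure (Space d))

/-- The Sobolev norm `‖f‖_n = ‖ √(1 + |k|²)^n ℱ f ‖_{L²}` of an element `f` of `H^n`. -/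
def normH {d : ℕ} (n : ℝ) (f : L2 d) : ℝ :=
  (eLpNorm (weightedFourier n f) 2 (volume : Measure (Space d))).toReal

/-- The constants `K` such that, for all `f ∈ H^a` and `g ∈ H^n`, the pointwise product `f g`
belongs to `H^n` and `‖f g‖_n ≤ K ‖f‖_a ‖g‖_n`. -/
def lowOrderConstants (d : ℕ) (n a : ℝ) : Set ℝ :=
  {K | ∀ f g : L2 d, MemH a f → MemH n g →
    ∃ h : L2 d, (∀ᵐ x, h x = f x * g x) ∧ MemH n h ∧
      normH n h ≤ K * normH a f * normH n g}

/-- The constants `K` such that, for all `f, g ∈ H^n`, the pointwise product `f g`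
belongs to `H^n` and `‖f g‖_n ≤ K max (‖f‖_a ‖g‖_n, ‖f‖_n ‖g‖_a)`. -/
def highOrderConstants (d : ℕ) (n a : ℝ) : Set ℝ :=
  {K | ∀ f g : L2 d, MemH n f → MemH n g →
    ∃ h : L2 d, (∀ᵐ x, h x = f x * g x) ∧ MemH n h ∧
      normH n h ≤ K * max (normH a f * normH n g) (normH n f * normH a g)}

/-- `E(s) = s^s` for `s > 0`, and `E(0) = 1` (real powers satisfy `0 ^ 0 = 1`). -/
def E (s : ℝ) : ℝ := s ^ s

/-- `S_{a,d}`, for `a > d/2`. -/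
def S (a : ℝ) (d : ℕ) : ℝ :=
  1 / (4 * Real.pi) ^ ((d : ℝ) / 4) * Real.sqrt (Real.Gamma (a - d / 2) / Real.Gamma a)

/-- `E_{ℓ,a,d}`, for `a > d/2` and `0 ≤ ℓ ≤ a`. -/
def E₃ (l a : ℝ) (d : ℕ) : ℝ :=
  (E (l / (2 * a)) * E (1 / 2 - l / (2 * a)) /
    (E (1 / 2 + l / (2 * a)) * E (1 - l / (2 * a)))) ^ ((d : ℝ) / 2)

/-- `E_{n,ℓ,a,d}` in the case `0 ≤ n ≤ d/2 < a`. -/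
def lowOrderE (_n l a : ℝ) (d : ℕ) : ℝ := E₃ l a d

/-- `E_{n,ℓ,a,d}` in the case `n ≥ a > d/2`. -/
def highOrderE (n l a : ℝ) (d : ℕ) : ℝ :=
  if l < a / 2 then E₃ l a d
  else if l ≤ n - a / 2 then (16 / 27 : ℝ) ^ ((d : ℝ) / 4)
  else E₃ (n - l) a d

/-- `n₊`, the least natural number that is `≥ n`. -/
def plus (n : ℝ) : ℕ := ⌈n⌉₊

/-- The sum of `binom(n, ℓ)₊ c(ℓ)` over the lattice `Λ(n)`, whose points are `ℓ = j n / n₊` for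
`j = 0, …, n₊`, with `binom(n, ℓ)₊ = binom(n₊, j)`. For `n = 0` the only point is `ℓ = 0`. -/
def latticeSum (n : ℝ) (c : ℝ → ℝ) : ℝ :=
  ∑ j ∈ Finset.range (plus n + 1), ((plus n).choose j : ℝ) * c (j * (n / plus n))

/-- `a_n = (n₊/n · a/2)₊`, for `n ≥ a > 0`. -/
def aSub (n a : ℝ) : ℕ := plus (plus n / n * (a / 2))

/-- `u_{n,a,d}`, for `n ≥ a > d/2`. In this range `1 ≤ a_n ≤ n₊`, so that the subtractions of
natural numbers are not truncated. -/
def u (n a : ℝ) (d : ℕ) : ℝ :=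
  1 + ((27 / 16 : ℝ) ^ ((d : ℝ) / 4) - 1) / 2 ^ (plus n - aSub n a) *
    ((plus n).choose (plus n - aSub n a + 1) : ℝ)

end

end SobolevProduct

namespace SobolevProduct

/-! The Fourier transform turns the product `f g` into `(2π)^(-d/2)` times a convolution, so
everything reduces to `L²` bounds for convolutions of the moduli of the transforms. Write `w(k) =
√(1 + |k|²)`. Since `w(k) ≤ w(h) + w(k - h)` and `t ↦ t^s` is subadditive for `s = n/n₊ ≤ 1`, the
binomial theorem with the integer exponent `n₊` spreads `w(k)^n` over the lattice (`wt_le_sum`). It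
remains to bound the `L²` norm of the convolution of `w^l |ℱf|` with `w^(n-l) |ℱg|`.

For any `m` in `[0, a]`, put `R = w^(-2a)` and `x = m/(2a)`, and split off `R^(1/2-x)` from the
first factor and `R^x` from the second. Hölder and the sharp Young inequality give the bound `E₃ m a
d * (∫ R)^(1/2)` times the norms of `f` at order `l + a - m` and of `g` at order `n - l + m`
(`l2_lconv_wt_le`). Together with `(2π)^(-d/2)`, the integral of `R` produces `S`. For low orders
take `m = l`. For high orders both Sobolev orders must lie in `[a, n]`; their sum is `n + a`, so
interpolation bounds the product of norms by the required maximum. This allows `m` between `l + a -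
n` and `l`, and the point of this window closest to `a/2`, where `E₃` is smallest, gives the three
cases of `highOrderE`.

Young's inequality with its optimal constant is proved on the line by monotone transport to
Gaussians: the Jacobian of a map of the plane is estimated by AM–GM, and a Gaussian integral is left
(`lintegral_young_of_continuous`). Fatou removes the regularity assumptions, and tensorisation gives
the constant in dimension `d`.

The explicit bounds follow from `x^x ≤ (1-x)^(1-x)` on `[0, 1/2]` and from an estimate of binomial
tails. A least constant exists because the product is determined almost everywhere by its factors,
so an infimum of constants is again a constant. -/

/-! ### Sharp Young inequality on the line by mass transport -/

/-- A positive continuous integrable function on the line has a normalised primitive that is a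
strictly increasing bijection onto `(0, 1)`. -/
lemma exists_cdf {f : ℝ → ℝ} (hc : Continuous f) (hpos : ∀ x, 0 < f x) (hi : Integrable f) :
    0 < ∫ x, f x ∧ ∃ F : ℝ → ℝ, (∀ x, HasDerivAt F (f x / ∫ x, f x) x) ∧ StrictMono F ∧
      Set.range F = Set.Ioo 0 1 := by
  have hI : 0 < ∫ x, f x := by
    rw [integral_pos_iff_support_of_nonneg (fun x => (hpos x).le) hi]
    have : Function.support f = Set.univ := by
      ext x; simp [(hpos x).ne']
    simp [this]
  refine ⟨hI, ?_⟩
  set I := ∫ x, f x with hIdef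
  set F : ℝ → ℝ := fun x => ((∫ t in (0 : ℝ)..x, f t) + ∫ t in Set.Iic (0 : ℝ), f t) / I
  have hF : ∀ x, HasDerivAt F (f x / I) x := fun x => by
    have := intervalIntegral.integral_hasDerivAt_right (hc.intervalIntegrable (0 : ℝ) x)
      hc.stronglyMeasurable.stronglyMeasurableAtFilter hc.continuousAt
    exact (this.add_const _).div_const I
  have hmono : StrictMono F := strictMono_of_hasDerivAt_pos hF fun x => div_pos (hpos x) hI
  have hsplit : (∫ t in Set.Iic (0 : ℝ), f t) + ∫ t in Set.Ioi (0 : ℝ), f t = I := by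
    rw [← Set.compl_Iic]
    exact integral_add_compl measurableSet_Iic hi
  have htop : Tendsto F atTop (𝓝 1) := by
    have h1 := intervalIntegral_tendsto_integral_Ioi (0 : ℝ) hi.integrableOn tendsto_id
    have h2 := (h1.add_const (∫ t in Set.Iic (0 : ℝ), f t)).div_const I
    rwa [add_comm (∫ t in Set.Ioi (0 : ℝ), f t), hsplit, div_self hI.ne'] at h2
  have hbot : Tendsto F atBot (𝓝 0) := by
    have h1 := (intervalIntegral_tendsto_integral_Iic (0 : ℝ) hi.integrableOn tendsto_id).neg
    have h2 := (h1.add_const (∫ t in Set.Iic (0 : ℝ), f t)).div_const I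
    rw [neg_add_cancel, zero_div] at h2
    refine h2.congr fun x => ?_
    simp only [F, id]
    rw [intervalIntegral.integral_symm]
    simp
  refine ⟨F, hF, hmono, Set.Subset.antisymm ?_ ?_⟩
  · rintro _ ⟨x, rfl⟩
    exact ⟨(hmono.monotone.le_of_tendsto hbot (x - 1)).trans_lt (hmono (sub_one_lt x)),
      (hmono (lt_add_one x)).trans_le (hmono.monotone.ge_of_tendsto htop (x + 1))⟩
  · rintro y ⟨h0, h1⟩
    have hFc : Continuous F := continuous_iff_continuousAt.2 fun x => (hF x).continuousAt
    exact mem_range_of_exists_le_of_exists_ge hFc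
      (((hbot.eventually_lt_const h0).exists).imp fun _ => le_of_lt)
      (((htop.eventually_const_lt h1).exists).imp fun _ => le_of_lt)

/-- Monotone transport of a positive continuous density to the Gaussian one. -/
lemma exists_gaussian_transport {f : ℝ → ℝ} (hc : Continuous f) (hpos : ∀ x, 0 < f x)
    (hi : Integrable f) :
    ∃ T T' : ℝ → ℝ, StrictMono T ∧ (∀ x, HasDerivAt T (T' x) x) ∧ (∀ x, 0 < T' x) ∧
      ∀ x, f x = (∫ x, f x) * ((√Real.pi)⁻¹ * Real.exp (-T x ^ 2) * T' x) := by
  obtain ⟨hI, F, hF, hFm, hFr⟩ := exists_cdf hc hpos hi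
  have hgi : Integrable fun x : ℝ => Real.exp (-x ^ 2) := by
    simpa using integrable_exp_neg_mul_sq (b := 1) one_pos
  obtain ⟨-, Φ, hΦ, hΦm, hΦr⟩ := exists_cdf (f := fun x : ℝ => Real.exp (-x ^ 2)) (by fun_prop)
    (fun x => Real.exp_pos _) hgi
  have hπ : ∫ x : ℝ, Real.exp (-x ^ 2) = √Real.pi := by simpa using integral_gaussian 1
  rw [hπ] at hΦ
  have hleft : Function.LeftInverse (Function.invFun Φ) Φ :=
    Function.leftInverse_invFun hΦm.injective
  have hright : ∀ p ∈ Set.Ioo (0 : ℝ) 1, Φ (Function.invFun Φ p) = p := by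
    intro p hp
    rw [← hΦr] at hp
    exact Function.invFun_eq hp
  have hmonoOn : StrictMonoOn (Function.invFun Φ) (Set.Ioo 0 1) := by
    intro p hp q hq hpq
    rw [← hright p hp, ← hright q hq] at hpq
    exact hΦm.lt_iff_lt.1 hpq
  have himage : Function.invFun Φ '' Set.Ioo 0 1 = Set.univ := by
    refine Set.eq_univ_of_forall fun x => ⟨Φ x, hΦr ▸ Set.mem_range_self x, hleft x⟩
  have hFmem : ∀ x, F x ∈ Set.Ioo (0 : ℝ) 1 := fun x => hFr ▸ Set.mem_range_self x
  have hder : ∀ p ∈ Set.Ioo (0 : ℝ) 1,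
      HasDerivAt (Function.invFun Φ) (Real.exp (-Function.invFun Φ p ^ 2) / √Real.pi)⁻¹ p := by
    intro p hp
    have hnhds : Set.Ioo (0 : ℝ) 1 ∈ 𝓝 p := isOpen_Ioo.mem_nhds hp
    refine HasDerivAt.of_local_left_inverse ?_ (hΦ _) (by positivity) ?_
    -- A monotone function has only jump discontinuities, and surjectivity onto the line excludes
    -- them.
    · exact hmonoOn.continuousAt_of_image_mem_nhds hnhds (by rw [himage]; exact univ_mem)
    · filter_upwards [hnhds] with q hq using hright q hq
  refine ⟨fun x => Function.invFun Φ (F x), fun x =>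
    (Real.exp (-Function.invFun Φ (F x) ^ 2) / √Real.pi)⁻¹ * (f x / ∫ x, f x), ?_, ?_, ?_, ?_⟩
  · exact fun x y hxy => hmonoOn (hFmem x) (hFmem y) (hFm hxy)
  · exact fun x => (hder _ (hFmem x)).comp x (hF x)
  · exact fun x => mul_pos (by positivity) (div_pos (hpos x) hI)
  · intro x
    have : √Real.pi ≠ 0 := by positivity
    field_simp

/-- The optimal constant in the trilinear form of Young's inequality on the line, as a function
of `1 / pᵢ' = mᵢ`. -/
noncomputable def youngConst (m₁ m₂ m₃ : ℝ) : ℝ :=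
  √(m₁ ^ m₁ / (1 - m₁) ^ (1 - m₁)) * √(m₂ ^ m₂ / (1 - m₂) ^ (1 - m₂)) *
    √(m₃ ^ m₃ / (1 - m₃) ^ (1 - m₃))

/-- Weighted AM–GM for the three pairwise products; the exponent of `s₁` is `m₂ + m₃ = 1 - m₁`. With
the `sᵢ` rescaled transport derivatives, the right-hand side becomes a Jacobian determinant. -/
lemma prod_rpow_le_quadratic {m₁ m₂ m₃ s₁ s₂ s₃ : ℝ} (h₁ : 0 ≤ m₁) (h₂ : 0 ≤ m₂) (h₃ : 0 ≤ m₃)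
    (hm : m₁ + m₂ + m₃ = 1) (hs₁ : 0 < s₁) (hs₂ : 0 < s₂) (hs₃ : 0 < s₃) :
    s₁ ^ (1 - m₁) * s₂ ^ (1 - m₂) * s₃ ^ (1 - m₃) ≤
      m₁ * (s₂ * s₃) + m₂ * (s₁ * s₃) + m₃ * (s₁ * s₂) := by
  refine le_trans (le_of_eq ?_) (Real.geom_mean_le_arith_mean3_weighted h₁ h₂ h₃
    (by positivity : 0 ≤ s₂ * s₃) (by positivity : 0 ≤ s₁ * s₃) (by positivity : 0 ≤ s₁ * s₂) hm)
  rw [Real.mul_rpow hs₂.le hs₃.le, Real.mul_rpow hs₁.le hs₃.le, Real.mul_rpow hs₁.le hs₂.le,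
    show 1 - m₁ = m₂ + m₃ by linarith, show 1 - m₂ = m₁ + m₃ by linarith,
    show 1 - m₃ = m₁ + m₂ by linarith, Real.rpow_add hs₁, Real.rpow_add hs₂, Real.rpow_add hs₃]
  ring

/-- Scale factors that turn `Σ κᵢ² eᵢ ⊗ eᵢ` into a matrix of determinant one. -/
lemma exists_scales {m₁ m₂ m₃ : ℝ} (h₁ : 0 < m₁) (h₂ : 0 < m₂) (h₃ : 0 < m₃) :
    ∃ κ₁ κ₂ κ₃ : ℝ, 0 < κ₁ ∧ 0 < κ₂ ∧ 0 < κ₃ ∧ κ₂ * κ₃ = √m₁ ∧ κ₁ * κ₃ = √m₂ ∧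
      κ₁ * κ₂ = √m₃ := by
  have key : ∀ a b c : ℝ, 0 < a → 0 < b → 0 < c →
      √(√a * √b / √c) * √(√a * √c / √b) = √a := by
    intro a b c ha hb hc
    rw [← Real.sqrt_mul (by positivity)]
    congr 1
    have := Real.mul_self_sqrt ha.le
    have hb' : √b ≠ 0 := by positivity
    have hc' : √c ≠ 0 := by positivity
    field_simp
    nlinarith
  -- Multiplying two of the three equations and dividing by the remaining one isolates each `κᵢ ^
  -- 2`.
  refine ⟨√(√m₂ * √m₃ / √m₁), √(√m₁ * √m₃ / √m₂), √(√m₁ * √m₂ / √m₃),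
    by positivity, by positivity, by positivity, ?_, ?_, ?_⟩
  · exact key m₁ m₃ m₂ h₁ h₃ h₂
  · rw [mul_comm √m₁ √m₂]; exact key m₂ m₃ m₁ h₂ h₃ h₁
  · rw [mul_comm √m₂ √m₃, mul_comm √m₁ √m₃]; exact key m₃ m₂ m₁ h₃ h₂ h₁

/-- The integral of a Gaussian on the plane whose quadratic form has determinant one. -/
lemma lintegral_gaussian_plane {μ₁ μ₂ μ₃ : ℝ} (h₁ : 0 < μ₁) (h₃ : 0 < μ₃)
    (hdet : μ₁ * μ₂ + μ₁ * μ₃ + μ₂ * μ₃ = 1) :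
    ∫⁻ z : ℝ × ℝ, ENNReal.ofReal
      (Real.exp (-(μ₂ * z.1 ^ 2 + μ₁ * z.2 ^ 2 + μ₃ * (z.1 - z.2) ^ 2))) =
      ENNReal.ofReal Real.pi := by
  have gauss : ∀ b : ℝ, 0 < b → ∀ c : ℝ,
      ∫⁻ x : ℝ, ENNReal.ofReal (Real.exp (-b * (x - c) ^ 2)) = ENNReal.ofReal √(Real.pi / b) := by
    intro b hb c
    rw [lintegral_sub_right_eq_self (fun x => ENNReal.ofReal (Real.exp (-b * x ^ 2))) c,
      ← ofReal_integral_eq_lintegral_ofReal (integrable_exp_neg_mul_sq hb)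
        (Eventually.of_forall fun x => (Real.exp_pos _).le), integral_gaussian]
  have hs : 0 < μ₁ + μ₃ := by positivity
  rw [Measure.volume_eq_prod, lintegral_prod _ (by fun_prop)]
  have inner : ∀ x : ℝ, ∫⁻ y : ℝ, ENNReal.ofReal
      (Real.exp (-(μ₂ * x ^ 2 + μ₁ * y ^ 2 + μ₃ * (x - y) ^ 2))) =
      ENNReal.ofReal (Real.exp (-(μ₁ + μ₃)⁻¹ * (x - 0) ^ 2)) *
        ENNReal.ofReal √(Real.pi / (μ₁ + μ₃)) := by
    intro x
    -- Completing the square in `y` centres the Gaussian at `μ₃ x / (μ₁ + μ₃)`; by the determinant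
    -- condition the remaining coefficient of `x ^ 2` is `1 / (μ₁ + μ₃)`.
    rw [← gauss _ hs (μ₃ * x / (μ₁ + μ₃)), ← lintegral_const_mul _ (by fun_prop)]
    congr 1
    ext y
    rw [← ENNReal.ofReal_mul (Real.exp_pos _).le, ← Real.exp_add]
    congr 2
    have e : μ₂ = (1 - μ₁ * μ₃) / (μ₁ + μ₃) := by field_simp; linarith
    rw [e]
    field_simp
    ring
  simp only [inner]
  rw [lintegral_mul_const _ (by fun_prop), gauss _ (by positivity),
    ← ENNReal.ofReal_mul (by positivity), ← Real.sqrt_mul (by positivity)]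
  congr 1
  rw [Real.sqrt_eq_iff_mul_self_eq (by positivity) (by positivity)]
  field_simp

/-- Each `κ₁` occurs in `κ₁ κ₃ = √m₂` and `κ₁ κ₂ = √m₃`, so its exponent `m₂ + m₃` is exactly what
`∏ √mᵢ ^ mᵢ` requires. This collects the scale factors left over by AM–GM. -/
lemma prod_scales_eq_youngConst {m₁ m₂ m₃ κ₁ κ₂ κ₃ : ℝ} (h₁ : 0 < m₁) (h₂ : 0 < m₂)
    (h₃ : 0 < m₃) (hm : m₁ + m₂ + m₃ = 1) (k₁ : 0 < κ₁) (k₂ : 0 < κ₂) (k₃ : 0 < κ₃)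
    (e₁ : κ₂ * κ₃ = √m₁) (e₂ : κ₁ * κ₃ = √m₂) (e₃ : κ₁ * κ₂ = √m₃) :
    (κ₁ / √(1 - m₁)) ^ (1 - m₁) * (κ₂ / √(1 - m₂)) ^ (1 - m₂) * (κ₃ / √(1 - m₃)) ^ (1 - m₃) =
      youngConst m₁ m₂ m₃ := by
  have c₁ : 0 < 1 - m₁ := by linarith
  have c₂ : 0 < 1 - m₂ := by linarith
  have c₃ : 0 < 1 - m₃ := by linarith
  have hsq : ∀ x y : ℝ, 0 < x → √x ^ y = √(x ^ y) := fun x y hx => by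
    rw [Real.sqrt_eq_rpow, Real.sqrt_eq_rpow, ← Real.rpow_mul hx.le, ← Real.rpow_mul hx.le,
      mul_comm]
  have hk : κ₁ ^ (1 - m₁) * κ₂ ^ (1 - m₂) * κ₃ ^ (1 - m₃) =
      √(m₁ ^ m₁) * √(m₂ ^ m₂) * √(m₃ ^ m₃) := by
    rw [← hsq _ _ h₁, ← hsq _ _ h₂, ← hsq _ _ h₃, ← e₁, ← e₂, ← e₃,
      Real.mul_rpow k₂.le k₃.le, Real.mul_rpow k₁.le k₃.le, Real.mul_rpow k₁.le k₂.le,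
      show 1 - m₁ = m₂ + m₃ by linarith, show 1 - m₂ = m₁ + m₃ by linarith,
      show 1 - m₃ = m₁ + m₂ by linarith, Real.rpow_add k₁, Real.rpow_add k₂, Real.rpow_add k₃]
    ring
  rw [Real.div_rpow k₁.le (by positivity), Real.div_rpow k₂.le (by positivity),
    Real.div_rpow k₃.le (by positivity), hsq _ _ c₁, hsq _ _ c₂, hsq _ _ c₃, youngConst,
    Real.sqrt_div (by positivity), Real.sqrt_div (by positivity), Real.sqrt_div (by positivity),
    div_mul_div_comm, div_mul_div_comm, hk, div_mul_div_comm, div_mul_div_comm]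

/-- A quadratic form composed with a linear map is dominated by the diagonal form. -/
lemma quadratic_le_diagonal {κ₁ κ₂ κ₃ : ℝ} (τ₁ τ₂ τ₃ : ℝ)
    (hdet : κ₁ ^ 2 * κ₂ ^ 2 + κ₁ ^ 2 * κ₃ ^ 2 + κ₂ ^ 2 * κ₃ ^ 2 = 1) :
    κ₂ ^ 2 * (κ₁ * τ₁ + κ₃ * τ₃) ^ 2 + κ₁ ^ 2 * (κ₂ * τ₂ + κ₃ * τ₃) ^ 2 +
      κ₃ ^ 2 * (κ₁ * τ₁ + κ₃ * τ₃ - (κ₂ * τ₂ + κ₃ * τ₃)) ^ 2 ≤ τ₁ ^ 2 + τ₂ ^ 2 + τ₃ ^ 2 := by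
  -- With `L τ = (κ₁ τ₁ + κ₃ τ₃, κ₂ τ₂ + κ₃ τ₃)`, the matrix of the form is `(L Lᵀ)⁻¹`, so the
  -- composite is an orthogonal projection. The defect is the projection onto the kernel of `L`,
  -- spanned by the unit vector `(κ₂κ₃, κ₁κ₃, -κ₁κ₂)`.
  have key : τ₁ ^ 2 + τ₂ ^ 2 + τ₃ ^ 2 -
      (κ₂ ^ 2 * (κ₁ * τ₁ + κ₃ * τ₃) ^ 2 + κ₁ ^ 2 * (κ₂ * τ₂ + κ₃ * τ₃) ^ 2 +
      κ₃ ^ 2 * (κ₁ * τ₁ + κ₃ * τ₃ - (κ₂ * τ₂ + κ₃ * τ₃)) ^ 2) =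
      (κ₂ * κ₃ * τ₁ + κ₁ * κ₃ * τ₂ - κ₁ * κ₂ * τ₃) ^ 2 := by
    linear_combination (- τ₁ ^ 2 - τ₂ ^ 2 - τ₃ ^ 2) * hdet
  nlinarith [sq_nonneg (κ₂ * κ₃ * τ₁ + κ₁ * κ₃ * τ₂ - κ₁ * κ₂ * τ₃)]

/-- The integral of a nonnegative function over the plane bounds the integral of its pull-back by
a map of the form `(x, y) ↦ (l₁ T₁(x) + l₃ T₃(x+y), l₂ T₂(y) + l₃ T₃(x+y))`. -/
lemma lintegral_comp_transport_le {T₁ T₂ T₃ T₁' T₂' T₃' : ℝ → ℝ} {l₁ l₂ l₃ : ℝ} (hl₁ : 0 < l₁)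
    (hl₂ : 0 < l₂) (hl₃ : 0 < l₃) (hT₁ : StrictMono T₁) (hT₂ : StrictMono T₂) (hT₃ : StrictMono T₃)
    (hd₁ : ∀ x, HasDerivAt T₁ (T₁' x) x) (hd₂ : ∀ x, HasDerivAt T₂ (T₂' x) x)
    (hd₃ : ∀ x, HasDerivAt T₃ (T₃' x) x) (G : ℝ × ℝ → ℝ≥0∞) :
    ∫⁻ z : ℝ × ℝ, ENNReal.ofReal |l₁ * l₂ * (T₁' z.1 * T₂' z.2) +
        l₁ * l₃ * (T₁' z.1 * T₃' (z.1 + z.2)) + l₂ * l₃ * (T₂' z.2 * T₃' (z.1 + z.2))| *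
        G (l₁ * T₁ z.1 + l₃ * T₃ (z.1 + z.2), l₂ * T₂ z.2 + l₃ * T₃ (z.1 + z.2)) ≤
      ∫⁻ z : ℝ × ℝ, G z := by
  set Θ : ℝ × ℝ → ℝ × ℝ := fun z =>
    (l₁ * T₁ z.1 + l₃ * T₃ (z.1 + z.2), l₂ * T₂ z.2 + l₃ * T₃ (z.1 + z.2))
  set Θ' : ℝ × ℝ → (ℝ × ℝ →L[ℝ] ℝ × ℝ) := fun z =>
    (Matrix.toLin (.finTwoProd ℝ) (.finTwoProd ℝ)
      !![l₁ * T₁' z.1 + l₃ * T₃' (z.1 + z.2), l₃ * T₃' (z.1 + z.2);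
        l₃ * T₃' (z.1 + z.2), l₂ * T₂' z.2 + l₃ * T₃' (z.1 + z.2)]).toContinuousLinearMap
  have hder : ∀ z ∈ Set.univ, HasFDerivWithinAt Θ (Θ' z) Set.univ z := by
    intro z _
    rw [hasFDerivWithinAt_univ]
    have hfst : HasFDerivAt (fun z : ℝ × ℝ => z.1) (ContinuousLinearMap.fst ℝ ℝ ℝ) z :=
      hasFDerivAt_fst
    have hsnd : HasFDerivAt (fun z : ℝ × ℝ => z.2) (ContinuousLinearMap.snd ℝ ℝ ℝ) z :=
      hasFDerivAt_snd
    have hsum : HasFDerivAt (fun z : ℝ × ℝ => z.1 + z.2)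
        (ContinuousLinearMap.fst ℝ ℝ ℝ + ContinuousLinearMap.snd ℝ ℝ ℝ) z :=
      hfst.add hsnd
    have h3 := ((hd₃ (z.1 + z.2)).comp_hasFDerivAt z hsum).const_mul l₃
    have h1 := ((hd₁ z.1).comp_hasFDerivAt z hfst).const_mul l₁
    have h2 := ((hd₂ z.2).comp_hasFDerivAt z hsnd).const_mul l₂
    refine ((h1.add h3).prodMk (h2.add h3)).congr_fderiv ?_
    simp only [Θ']
    rw [Matrix.toLin_finTwoProd_toContinuousLinearMap]
    ext <;> simp
  -- If the images agree and `x' < x`, the first coordinate forces `x + y < x' + y'`, hence `y <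
  -- y'`, and both terms of the second coordinate increase strictly.
  have hinj : Set.InjOn Θ Set.univ := by
    have aux : ∀ x y x' y' : ℝ, Θ (x, y) = Θ (x', y') → ¬ x' < x := by
      intro x y x' y' h hx
      have h1 : l₁ * T₁ x + l₃ * T₃ (x + y) = l₁ * T₁ x' + l₃ * T₃ (x' + y') :=
        congrArg Prod.fst h
      have h2 : l₂ * T₂ y + l₃ * T₃ (x + y) = l₂ * T₂ y' + l₃ * T₃ (x' + y') :=
        congrArg Prod.snd h
      have h3 : l₃ * T₃ (x + y) < l₃ * T₃ (x' + y') := by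
        have := mul_lt_mul_of_pos_left (hT₁ hx) hl₁
        linarith
      have h4 : x + y < x' + y' := hT₃.lt_iff_lt.1 (lt_of_mul_lt_mul_left h3 hl₃.le)
      have := mul_lt_mul_of_pos_left (hT₂ (show y < y' by linarith)) hl₂
      linarith
    rintro ⟨x, y⟩ - ⟨x', y'⟩ - h
    have hx : x = x' := le_antisymm (not_lt.1 (aux _ _ _ _ h)) (not_lt.1 (aux _ _ _ _ h.symm))
    subst hx
    have h1 : l₁ * T₁ x + l₃ * T₃ (x + y) = l₁ * T₁ x + l₃ * T₃ (x + y') := congrArg Prod.fst h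
    have h2 := hT₃.injective (mul_left_cancel₀ hl₃.ne' (add_left_cancel h1))
    rw [add_left_cancel h2]
  have hcv := lintegral_image_eq_lintegral_abs_det_fderiv_mul volume MeasurableSet.univ hder hinj G
  rw [Measure.restrict_univ] at hcv
  have hdet : ∀ z, (Θ' z).det = l₁ * l₂ * (T₁' z.1 * T₂' z.2) +
        l₁ * l₃ * (T₁' z.1 * T₃' (z.1 + z.2)) + l₂ * l₃ * (T₂' z.2 * T₃' (z.1 + z.2)) := by
    intro z
    simp only [Θ', LinearMap.det_toContinuousLinearMap, LinearMap.det_toLin,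
      Matrix.det_fin_two_of]
    ring
  simp only [hdet] at hcv
  exact hcv.symm.trans_le (setLIntegral_le_lintegral _ _)

/-- The sharp trilinear Young inequality on the line for positive continuous densities. -/
theorem lintegral_young_of_continuous {m₁ m₂ m₃ : ℝ} (h₁ : 0 < m₁) (h₂ : 0 < m₂) (h₃ : 0 < m₃)
    (hm : m₁ + m₂ + m₃ = 1) {f₁ f₂ f₃ : ℝ → ℝ} (hc₁ : Continuous f₁) (hc₂ : Continuous f₂)
    (hc₃ : Continuous f₃) (hp₁ : ∀ x, 0 < f₁ x) (hp₂ : ∀ x, 0 < f₂ x) (hp₃ : ∀ x, 0 < f₃ x)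
    (hi₁ : Integrable f₁) (hi₂ : Integrable f₂) (hi₃ : Integrable f₃) :
    ∫⁻ z : ℝ × ℝ, ENNReal.ofReal
        (f₁ z.1 ^ (1 - m₁) * f₂ z.2 ^ (1 - m₂) * f₃ (z.1 + z.2) ^ (1 - m₃)) ≤
      ENNReal.ofReal (youngConst m₁ m₂ m₃ * ((∫ x, f₁ x) ^ (1 - m₁) * (∫ x, f₂ x) ^ (1 - m₂) *
        (∫ x, f₃ x) ^ (1 - m₃))) := by
  have c₁ : 0 < 1 - m₁ := by linarith
  have c₂ : 0 < 1 - m₂ := by linarith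
  have c₃ : 0 < 1 - m₃ := by linarith
  obtain ⟨κ₁, κ₂, κ₃, k₁, k₂, k₃, e₁, e₂, e₃⟩ := exists_scales h₁ h₂ h₃
  obtain ⟨T₁, T₁', hT₁, hd₁, hT₁', hf₁⟩ := exists_gaussian_transport hc₁ hp₁ hi₁
  obtain ⟨T₂, T₂', hT₂, hd₂, hT₂', hf₂⟩ := exists_gaussian_transport hc₂ hp₂ hi₂
  obtain ⟨T₃, T₃', hT₃, hd₃, hT₃', hf₃⟩ := exists_gaussian_transport hc₃ hp₃ hi₃
  have hI₁ := (exists_cdf hc₁ hp₁ hi₁).1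
  have hI₂ := (exists_cdf hc₂ hp₂ hi₂).1
  have hI₃ := (exists_cdf hc₃ hp₃ hi₃).1
  set I₁ := ∫ x, f₁ x
  set I₂ := ∫ x, f₂ x
  set I₃ := ∫ x, f₃ x
  have q₁ : (κ₂ * κ₃) ^ 2 = m₁ := by rw [e₁, Real.sq_sqrt h₁.le]
  have q₂ : (κ₁ * κ₃) ^ 2 = m₂ := by rw [e₂, Real.sq_sqrt h₂.le]
  have q₃ : (κ₁ * κ₂) ^ 2 = m₃ := by rw [e₃, Real.sq_sqrt h₃.le]
  have hdet : κ₁ ^ 2 * κ₂ ^ 2 + κ₁ ^ 2 * κ₃ ^ 2 + κ₂ ^ 2 * κ₃ ^ 2 = 1 := by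
    linear_combination q₁ + q₂ + q₃ + hm
  set G : ℝ × ℝ → ℝ := fun z =>
    Real.exp (-(κ₂ ^ 2 * z.1 ^ 2 + κ₁ ^ 2 * z.2 ^ 2 + κ₃ ^ 2 * (z.1 - z.2) ^ 2)) with hG
  -- The factor `κ / √(1 - m)` is inserted so that AM–GM applied to `√(1 - m) / κ * T'` yields
  -- exactly the Jacobian of the transport map; the compensating powers multiply to `youngConst`.
  have hfac : ∀ {m κ I T T' : ℝ}, 0 < 1 - m → 0 < κ → 0 < I → 0 < T' →
      (I * ((√Real.pi)⁻¹ * Real.exp (-T ^ 2) * T')) ^ (1 - m) =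
        I ^ (1 - m) * ((√Real.pi)⁻¹ ^ (1 - m) * Real.exp (-(√(1 - m) * T) ^ 2) *
          ((κ / √(1 - m)) ^ (1 - m) * (√(1 - m) / κ * T') ^ (1 - m))) := by
    intro m κ I T T' hc hκ hI hT
    have hs : 0 < √(1 - m) := Real.sqrt_pos.2 hc
    rw [← Real.mul_rpow (by positivity) (by positivity), Real.mul_rpow hI.le (by positivity),
      Real.mul_rpow (by positivity) hT.le, Real.mul_rpow (by positivity) (Real.exp_pos _).le,
      ← Real.exp_mul, mul_pow, Real.sq_sqrt hc.le]
    congr 3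
    · congr 2; ring
    · field_simp
  -- The exponents sum to `2`, so the Gaussian normalisations cancel the value `π` of the plane
  -- integral.
  have hpi : (√Real.pi)⁻¹ ^ (1 - m₁) * (√Real.pi)⁻¹ ^ (1 - m₂) * (√Real.pi)⁻¹ ^ (1 - m₃) =
      Real.pi⁻¹ := by
    rw [← Real.rpow_add (by positivity), ← Real.rpow_add (by positivity),
      show 1 - m₁ + (1 - m₂) + (1 - m₃) = (2 : ℕ) by push_cast; linarith, Real.rpow_natCast,
      inv_pow, Real.sq_sqrt Real.pi_pos.le]
  set C := youngConst m₁ m₂ m₃ * (I₁ ^ (1 - m₁) * I₂ ^ (1 - m₂) * I₃ ^ (1 - m₃)) with hC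
  have hC0 : 0 ≤ C := by unfold C youngConst; positivity
  set l₁ := √(1 - m₁) * κ₁ with hl₁
  set l₂ := √(1 - m₂) * κ₂ with hl₂
  set l₃ := √(1 - m₃) * κ₃ with hl₃
  have hquad : ∀ s₁ s₂ s₃ t₁ t₂ t₃ : ℝ,
      (κ₂ * κ₃) ^ 2 * (s₂ / κ₂ * t₂ * (s₃ / κ₃ * t₃)) +
        (κ₁ * κ₃) ^ 2 * (s₁ / κ₁ * t₁ * (s₃ / κ₃ * t₃)) +
        (κ₁ * κ₂) ^ 2 * (s₁ / κ₁ * t₁ * (s₂ / κ₂ * t₂)) =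
      s₁ * κ₁ * (s₂ * κ₂) * (t₁ * t₂) + s₁ * κ₁ * (s₃ * κ₃) * (t₁ * t₃) +
        s₂ * κ₂ * (s₃ * κ₃) * (t₂ * t₃) := by
    intro s₁ s₂ s₃ t₁ t₂ t₃
    field_simp
    ring
  have hpt : ∀ x y : ℝ, f₁ x ^ (1 - m₁) * f₂ y ^ (1 - m₂) * f₃ (x + y) ^ (1 - m₃) ≤
      C * Real.pi⁻¹ * (|l₁ * l₂ * (T₁' x * T₂' y) + l₁ * l₃ * (T₁' x * T₃' (x + y)) +
        l₂ * l₃ * (T₂' y * T₃' (x + y))| *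
        G (l₁ * T₁ x + l₃ * T₃ (x + y), l₂ * T₂ y + l₃ * T₃ (x + y))) := by
    intro x y
    have hs₁ : 0 < √(1 - m₁) := Real.sqrt_pos.2 c₁
    have hs₂ : 0 < √(1 - m₂) := Real.sqrt_pos.2 c₂
    have hs₃ : 0 < √(1 - m₃) := Real.sqrt_pos.2 c₃
    have t₁ := hT₁' x
    have t₂ := hT₂' y
    have t₃ := hT₃' (x + y)
    rw [hf₁ x, hf₂ y, hf₃ (x + y), hfac c₁ k₁ hI₁ t₁, hfac c₂ k₂ hI₂ t₂, hfac c₃ k₃ hI₃ t₃,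
      abs_of_pos (by positivity)]
    have hJ := prod_rpow_le_quadratic h₁.le h₂.le h₃.le hm
      (show 0 < √(1 - m₁) / κ₁ * T₁' x by positivity)
      (show 0 < √(1 - m₂) / κ₂ * T₂' y by positivity)
      (show 0 < √(1 - m₃) / κ₃ * T₃' (x + y) by positivity)
    have hJ' : m₁ * (√(1 - m₂) / κ₂ * T₂' y * (√(1 - m₃) / κ₃ * T₃' (x + y))) +
        m₂ * (√(1 - m₁) / κ₁ * T₁' x * (√(1 - m₃) / κ₃ * T₃' (x + y))) +
        m₃ * (√(1 - m₁) / κ₁ * T₁' x * (√(1 - m₂) / κ₂ * T₂' y)) =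
        l₁ * l₂ * (T₁' x * T₂' y) + l₁ * l₃ * (T₁' x * T₃' (x + y)) +
          l₂ * l₃ * (T₂' y * T₃' (x + y)) := by
      have := hquad √(1 - m₁) √(1 - m₂) √(1 - m₃) (T₁' x) (T₂' y) (T₃' (x + y))
      rwa [q₁, q₂, q₃] at this
    have hE : Real.exp (-(√(1 - m₁) * T₁ x) ^ 2) * Real.exp (-(√(1 - m₂) * T₂ y) ^ 2) *
        Real.exp (-(√(1 - m₃) * T₃ (x + y)) ^ 2) ≤
        G (l₁ * T₁ x + l₃ * T₃ (x + y), l₂ * T₂ y + l₃ * T₃ (x + y)) := by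
      rw [hG, ← Real.exp_add, ← Real.exp_add]
      refine Real.exp_le_exp.2 ?_
      have := quadratic_le_diagonal (√(1 - m₁) * T₁ x) (√(1 - m₂) * T₂ y)
        (√(1 - m₃) * T₃ (x + y)) hdet
      have a₁ : l₁ * T₁ x + l₃ * T₃ (x + y) =
          κ₁ * (√(1 - m₁) * T₁ x) + κ₃ * (√(1 - m₃) * T₃ (x + y)) := by rw [hl₁, hl₃]; ring
      have a₂ : l₂ * T₂ y + l₃ * T₃ (x + y) =
          κ₂ * (√(1 - m₂) * T₂ y) + κ₃ * (√(1 - m₃) * T₃ (x + y)) := by rw [hl₂, hl₃]; ring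
      rw [a₁, a₂]
      linarith
    have hprod := mul_le_mul (hJ'.symm ▸ hJ) hE (by positivity) (by positivity)
    have hfinal := mul_le_mul_of_nonneg_left hprod (show 0 ≤ C * Real.pi⁻¹ by positivity)
    refine le_trans (le_of_eq ?_) hfinal
    rw [hC, ← prod_scales_eq_youngConst h₁ h₂ h₃ hm k₁ k₂ k₃ e₁ e₂ e₃, ← hpi]
    ring
  calc _ ≤ ∫⁻ z : ℝ × ℝ, ENNReal.ofReal (C * Real.pi⁻¹) *
        (ENNReal.ofReal |l₁ * l₂ * (T₁' z.1 * T₂' z.2) + l₁ * l₃ * (T₁' z.1 * T₃' (z.1 + z.2)) +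
          l₂ * l₃ * (T₂' z.2 * T₃' (z.1 + z.2))| * ENNReal.ofReal
        (G (l₁ * T₁ z.1 + l₃ * T₃ (z.1 + z.2), l₂ * T₂ z.2 + l₃ * T₃ (z.1 + z.2)))) := by
        refine lintegral_mono fun z => ?_
        rw [← ENNReal.ofReal_mul (abs_nonneg _), ← ENNReal.ofReal_mul (by positivity)]
        exact ENNReal.ofReal_le_ofReal (hpt z.1 z.2)
    _ = ENNReal.ofReal (C * Real.pi⁻¹) * _ := lintegral_const_mul' _ _ ENNReal.ofReal_ne_top
    _ ≤ ENNReal.ofReal (C * Real.pi⁻¹) * ENNReal.ofReal Real.pi := by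
        gcongr
        refine (lintegral_comp_transport_le (by positivity) (by positivity) (by positivity)
          hT₁ hT₂ hT₃ hd₁ hd₂ hd₃ fun z => ENNReal.ofReal (G z)).trans_eq ?_
        exact lintegral_gaussian_plane (pow_pos k₁ 2) (pow_pos k₃ 2) hdet
    _ = ENNReal.ofReal C := by
        rw [← ENNReal.ofReal_mul (by positivity), mul_assoc, inv_mul_cancel₀ Real.pi_ne_zero,
          mul_one]

/-! ### From continuous densities to measurable functions -/

/-- The trilinear form of Young's convolution inequality with constant `C`, where `cᵢ = 1 / pᵢ`
and the functions are normalised by `∫ fᵢ = ‖fᵢ ^ cᵢ‖ ^ pᵢ`. -/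
def YoungBound {G : Type*} [Add G] [MeasurableSpace G] (μ : Measure G) (c₁ c₂ c₃ : ℝ)
    (C : ℝ≥0∞) : Prop :=
  ∀ f₁ f₂ f₃ : G → ℝ≥0∞, Measurable f₁ → Measurable f₂ → Measurable f₃ →
    ∫⁻ x, ∫⁻ y, f₁ x ^ c₁ * f₂ y ^ c₂ * f₃ (x + y) ^ c₃ ∂μ ∂μ ≤
      C * ((∫⁻ x, f₁ x ∂μ) ^ c₁ * (∫⁻ x, f₂ x ∂μ) ^ c₂ * (∫⁻ x, f₃ x ∂μ) ^ c₃)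

/-- Approximation of an integrable density by positive continuous ones. -/
lemma exists_continuous_approx {f : ℝ → ℝ≥0∞} (hf : Measurable f) (hI : ∫⁻ x, f x ≠ ⊤) :
    ∃ g : ℕ → ℝ → ℝ, (∀ n, Continuous (g n)) ∧ (∀ n x, 0 < g n x) ∧ (∀ n, Integrable (g n)) ∧
      (∀ᵐ x, Tendsto (fun n => ENNReal.ofReal (g n x)) atTop (𝓝 (f x))) ∧
      Tendsto (fun n => ENNReal.ofReal (∫ x, g n x)) atTop (𝓝 (∫⁻ x, f x)) := by
  have hfin : ∀ᵐ x, f x < ⊤ := ae_lt_top hf hI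
  set F : ℝ → ℝ := fun x => (f x).toReal with hF
  have hFi : Integrable F := integrable_toReal_of_lintegral_ne_top hf.aemeasurable hI
  have hFI : ENNReal.ofReal (∫ x, F x) = ∫⁻ x, f x := by
    rw [hF, integral_toReal hf.aemeasurable hfin, ENNReal.ofReal_toReal hI]
  choose φ hφs hφ hφc hφi using fun n : ℕ =>
    hFi.exists_hasCompactSupport_integral_sub_le (ε := 1 / ((n : ℝ) + 1)) (by positivity)
  have hgi : Integrable fun x : ℝ => Real.exp (-x ^ 2) := by
    simpa using integrable_exp_neg_mul_sq (b := 1) one_pos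
  -- The absolute value does not increase the distance to the nonnegative `F`, and the small
  -- Gaussian makes the approximants strictly positive, as the transport requires.
  set g : ℕ → ℝ → ℝ := fun n x => |φ n x| + 1 / ((n : ℝ) + 1) * Real.exp (-x ^ 2) with hg
  have hgc : ∀ n, Continuous (g n) := fun n => by
    have := hφc n
    fun_prop
  have hgint : ∀ n, Integrable (g n) := fun n => (hφi n).abs.add (hgi.const_mul _)
  have hL1 : Tendsto (fun n => eLpNorm (g n - F) 1 volume) atTop (𝓝 0) := by
    have hb : ∀ n, eLpNorm (g n - F) 1 volume ≤
        ENNReal.ofReal (1 / ((n : ℝ) + 1) * (1 + ∫ x : ℝ, Real.exp (-x ^ 2))) := by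
      intro n
      rw [eLpNorm_one_eq_lintegral_enorm]
      have hi : Integrable fun x => ‖F x - φ n x‖ + 1 / ((n : ℝ) + 1) * Real.exp (-x ^ 2) :=
        (hFi.sub (hφi n)).norm.add (hgi.const_mul _)
      calc ∫⁻ x, ‖(g n - F) x‖ₑ ≤
          ∫⁻ x, ENNReal.ofReal (‖F x - φ n x‖ + 1 / ((n : ℝ) + 1) * Real.exp (-x ^ 2)) := by
            refine lintegral_mono fun x => ?_
            rw [← ofReal_norm]
            refine ENNReal.ofReal_le_ofReal ?_
            have h0 : 0 ≤ F x := ENNReal.toReal_nonneg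
            have h1 : |(|φ n x| - F x)| ≤ |F x - φ n x| := by
              have := abs_abs_sub_abs_le (φ n x) (F x)
              rwa [abs_of_nonneg h0, abs_sub_comm (φ n x)] at this
            have h2 : 0 < 1 / ((n : ℝ) + 1) * Real.exp (-x ^ 2) := by positivity
            rw [Real.norm_eq_abs, Real.norm_eq_abs]
            calc |(g n - F) x| = |(|φ n x| - F x) + 1 / ((n : ℝ) + 1) * Real.exp (-x ^ 2)| := by
                  congr 1; simp only [hg, Pi.sub_apply]; ring
              _ ≤ |(|φ n x| - F x)| + |1 / ((n : ℝ) + 1) * Real.exp (-x ^ 2)| := abs_add_le _ _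
              _ ≤ _ := by rw [abs_of_pos h2]; gcongr
        _ = ENNReal.ofReal (∫ x, (‖F x - φ n x‖ + 1 / ((n : ℝ) + 1) * Real.exp (-x ^ 2))) :=
            (ofReal_integral_eq_lintegral_ofReal hi
              (Eventually.of_forall fun x => by positivity)).symm
        _ ≤ _ := by
            refine ENNReal.ofReal_le_ofReal ?_
            have hadd := integral_add (f := fun x => ‖F x - φ n x‖) (hFi.sub (hφi n)).norm
              (hgi.const_mul (1 / ((n : ℝ) + 1)))
            rw [hadd, integral_const_mul]
            have := hφ n
            linarith
    refine tendsto_of_tendsto_of_tendsto_of_le_of_le tendsto_const_nhds ?_ (fun _ => zero_le) hb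
    have := (tendsto_one_div_add_atTop_nhds_zero_nat (𝕜 := ℝ)).mul_const
      (1 + ∫ x : ℝ, Real.exp (-x ^ 2))
    rw [zero_mul] at this
    simpa using ENNReal.tendsto_ofReal this
  obtain ⟨ns, hns, hae⟩ := (tendstoInMeasure_of_tendsto_eLpNorm one_ne_zero
    (fun n => (hgc n).aestronglyMeasurable) hFi.aestronglyMeasurable hL1).exists_seq_tendsto_ae
  refine ⟨fun n => g (ns n), fun n => hgc _, fun n x => by simp only [hg]; positivity,
    fun n => hgint _, ?_, ?_⟩
  · filter_upwards [hae, hfin] with x hx hx'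
    have := ENNReal.tendsto_ofReal hx
    rwa [hF, ENNReal.ofReal_toReal hx'.ne] at this
  · rw [← hFI]
    exact ENNReal.tendsto_ofReal ((tendsto_integral_of_L1' F hFi.aestronglyMeasurable
      (Eventually.of_forall hgint) hL1).comp hns.tendsto_atTop)

lemma youngConst_pos {m₁ m₂ m₃ : ℝ} (h₁ : 0 < m₁) (h₂ : 0 < m₂) (h₃ : 0 < m₃)
    (hm : m₁ + m₂ + m₃ = 1) : 0 < youngConst m₁ m₂ m₃ := by
  have c₁ : 0 < 1 - m₁ := by linarith
  have c₂ : 0 < 1 - m₂ := by linarith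
  have c₃ : 0 < 1 - m₃ := by linarith
  unfold youngConst
  positivity

/-- The trilinear form vanishes if one of the functions does. -/
lemma lintegral_young_eq_zero {c₁ c₂ c₃ : ℝ} (h₁ : 0 < c₁) (h₂ : 0 < c₂) (h₃ : 0 < c₃)
    {f₁ f₂ f₃ : ℝ → ℝ≥0∞} (hf₁ : Measurable f₁) (hf₂ : Measurable f₂) (hf₃ : Measurable f₃)
    (h : ∫⁻ x, f₁ x = 0 ∨ ∫⁻ x, f₂ x = 0 ∨ ∫⁻ x, f₃ x = 0) :
    ∫⁻ x, ∫⁻ y, f₁ x ^ c₁ * f₂ y ^ c₂ * f₃ (x + y) ^ c₃ = 0 := by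
  rcases h with h | h | h
  · rw [lintegral_eq_zero_iff hf₁] at h
    rw [lintegral_congr_ae (g := fun _ => 0), lintegral_zero]
    filter_upwards [h] with x hx
    simp [hx, h₁]
  · rw [lintegral_eq_zero_iff hf₂] at h
    convert lintegral_zero with x
    rw [lintegral_congr_ae (g := fun _ => 0), lintegral_zero]
    filter_upwards [h] with y hy
    simp [hy, h₂]
  · rw [lintegral_eq_zero_iff hf₃] at h
    convert lintegral_zero with x
    rw [lintegral_congr_ae (g := fun _ => 0), lintegral_zero]
    filter_upwards [(measurePreserving_add_left volume x).quasiMeasurePreserving.ae h] with y hy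
    simp [hy, h₃]

/-- Fatou's lemma along positive continuous approximants: the integrands converge almost everywhere
in the plane, and the right-hand sides converge because the integrals are finite and the exponents
positive. -/
lemma lintegral_young_of_ne_top {m₁ m₂ m₃ : ℝ} (h₁ : 0 < m₁) (h₂ : 0 < m₂) (h₃ : 0 < m₃)
    (hm : m₁ + m₂ + m₃ = 1) {f₁ f₂ f₃ : ℝ → ℝ≥0∞} (hf₁ : Measurable f₁) (hf₂ : Measurable f₂)
    (hf₃ : Measurable f₃) (hI₁ : ∫⁻ x, f₁ x ≠ ⊤) (hI₂ : ∫⁻ x, f₂ x ≠ ⊤) (hI₃ : ∫⁻ x, f₃ x ≠ ⊤) :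
    ∫⁻ x, ∫⁻ y, f₁ x ^ (1 - m₁) * f₂ y ^ (1 - m₂) * f₃ (x + y) ^ (1 - m₃) ≤
      ENNReal.ofReal (youngConst m₁ m₂ m₃) * ((∫⁻ x, f₁ x) ^ (1 - m₁) * (∫⁻ x, f₂ x) ^ (1 - m₂) *
        (∫⁻ x, f₃ x) ^ (1 - m₃)) := by
  have c₁ : 0 < 1 - m₁ := by linarith
  have c₂ : 0 < 1 - m₂ := by linarith
  have c₃ : 0 < 1 - m₃ := by linarith
  obtain ⟨g₁, gc₁, gp₁, gi₁, ga₁, gt₁⟩ := exists_continuous_approx hf₁ hI₁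
  obtain ⟨g₂, gc₂, gp₂, gi₂, ga₂, gt₂⟩ := exists_continuous_approx hf₂ hI₂
  obtain ⟨g₃, gc₃, gp₃, gi₃, ga₃, gt₃⟩ := exists_continuous_approx hf₃ hI₃
  have hlim : ∀ {a b c : ℕ → ℝ≥0∞} {A B D : ℝ≥0∞}, A ≠ ⊤ → B ≠ ⊤ → D ≠ ⊤ →
      Tendsto a atTop (𝓝 A) → Tendsto b atTop (𝓝 B) → Tendsto c atTop (𝓝 D) →
      Tendsto (fun n => a n ^ (1 - m₁) * b n ^ (1 - m₂) * c n ^ (1 - m₃)) atTop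
        (𝓝 (A ^ (1 - m₁) * B ^ (1 - m₂) * D ^ (1 - m₃))) := by
    intro a b c A B D hA hB hD ha hb hc
    have hA' := ENNReal.rpow_ne_top_of_nonneg c₁.le hA
    have hB' := ENNReal.rpow_ne_top_of_nonneg c₂.le hB
    have hD' := ENNReal.rpow_ne_top_of_nonneg c₃.le hD
    exact ENNReal.Tendsto.mul (ENNReal.Tendsto.mul ((ENNReal.continuous_rpow_const.tendsto _).comp ha)
      (Or.inr hB') ((ENNReal.continuous_rpow_const.tendsto _).comp hb) (Or.inr hA')) (Or.inr hD')
      ((ENNReal.continuous_rpow_const.tendsto _).comp hc) (Or.inr (ENNReal.mul_ne_top hA' hB'))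
  -- The shear `(x, y) ↦ (x, x + y)` preserves Lebesgue measure, so null sets pull back to null sets
  -- under addition.
  have hsum : ∀ {P : ℝ → Prop}, (∀ᵐ x, P x) → ∀ᵐ z : ℝ × ℝ, P (z.1 + z.2) := fun h =>
    (Measure.quasiMeasurePreserving_snd.comp
      (measurePreserving_prod_add volume volume).quasiMeasurePreserving).ae h
  have hfst : ∀ {P : ℝ → Prop}, (∀ᵐ x, P x) → ∀ᵐ z : ℝ × ℝ, P z.1 := fun h =>
    Measure.quasiMeasurePreserving_fst.ae h
  have hsnd : ∀ {P : ℝ → Prop}, (∀ᵐ x, P x) → ∀ᵐ z : ℝ × ℝ, P z.2 := fun h =>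
    Measure.quasiMeasurePreserving_snd.ae h
  have hprod : ∀ n, ∀ x y z : ℝ, ENNReal.ofReal
      (g₁ n x ^ (1 - m₁) * g₂ n y ^ (1 - m₂) * g₃ n z ^ (1 - m₃)) =
      ENNReal.ofReal (g₁ n x) ^ (1 - m₁) * ENNReal.ofReal (g₂ n y) ^ (1 - m₂) *
        ENNReal.ofReal (g₃ n z) ^ (1 - m₃) := by
    intro n x y z
    have p₁ := gp₁ n x
    have p₂ := gp₂ n y
    have p₃ := gp₃ n z
    rw [ENNReal.ofReal_mul (by positivity), ENNReal.ofReal_mul (by positivity),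
      ENNReal.ofReal_rpow_of_pos p₁, ENNReal.ofReal_rpow_of_pos p₂, ENNReal.ofReal_rpow_of_pos p₃]
  have hmeas : ∀ n, Measurable fun z : ℝ × ℝ => ENNReal.ofReal
      (g₁ n z.1 ^ (1 - m₁) * g₂ n z.2 ^ (1 - m₂) * g₃ n (z.1 + z.2) ^ (1 - m₃)) := by
    intro n
    have p₁ := (gc₁ n).measurable
    have p₂ := (gc₂ n).measurable
    have p₃ := (gc₃ n).measurable
    fun_prop
  calc ∫⁻ x, ∫⁻ y, f₁ x ^ (1 - m₁) * f₂ y ^ (1 - m₂) * f₃ (x + y) ^ (1 - m₃)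
      = ∫⁻ z : ℝ × ℝ, f₁ z.1 ^ (1 - m₁) * f₂ z.2 ^ (1 - m₂) * f₃ (z.1 + z.2) ^ (1 - m₃) := by
        rw [Measure.volume_eq_prod, lintegral_prod _ (by fun_prop)]
    _ = ∫⁻ z : ℝ × ℝ, liminf (fun n => ENNReal.ofReal
      (g₁ n z.1 ^ (1 - m₁) * g₂ n z.2 ^ (1 - m₂) * g₃ n (z.1 + z.2) ^ (1 - m₃))) atTop := by
        refine lintegral_congr_ae ?_
        filter_upwards [hfst ga₁, hsnd ga₂, hsum ga₃, hfst (ae_lt_top hf₁ hI₁),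
          hsnd (ae_lt_top hf₂ hI₂), hsum (ae_lt_top hf₃ hI₃)] with z t₁ t₂ t₃ l₁ l₂ l₃
        simp only [hprod]
        exact (hlim l₁.ne l₂.ne l₃.ne t₁ t₂ t₃).liminf_eq.symm
    _ ≤ liminf (fun n => ∫⁻ z : ℝ × ℝ, ENNReal.ofReal
      (g₁ n z.1 ^ (1 - m₁) * g₂ n z.2 ^ (1 - m₂) * g₃ n (z.1 + z.2) ^ (1 - m₃))) atTop :=
        lintegral_liminf_le hmeas
    _ ≤ liminf (fun n => ENNReal.ofReal (youngConst m₁ m₂ m₃) *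
        (ENNReal.ofReal (∫ x, g₁ n x) ^ (1 - m₁) * ENNReal.ofReal (∫ x, g₂ n x) ^ (1 - m₂) *
        ENNReal.ofReal (∫ x, g₃ n x) ^ (1 - m₃))) atTop := by
        refine liminf_le_liminf (Eventually.of_forall fun n => ?_)
        refine (lintegral_young_of_continuous h₁ h₂ h₃ hm (gc₁ n) (gc₂ n) (gc₃ n) (gp₁ n) (gp₂ n)
          (gp₃ n) (gi₁ n) (gi₂ n) (gi₃ n)).trans_eq ?_
        have p₁ := (exists_cdf (gc₁ n) (gp₁ n) (gi₁ n)).1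
        have p₂ := (exists_cdf (gc₂ n) (gp₂ n) (gi₂ n)).1
        have p₃ := (exists_cdf (gc₃ n) (gp₃ n) (gi₃ n)).1
        rw [ENNReal.ofReal_mul (youngConst_pos h₁ h₂ h₃ hm).le, ENNReal.ofReal_mul (by positivity),
          ENNReal.ofReal_mul (by positivity), ENNReal.ofReal_rpow_of_pos p₁,
          ENNReal.ofReal_rpow_of_pos p₂, ENNReal.ofReal_rpow_of_pos p₃]
    _ = _ := (ENNReal.Tendsto.const_mul (hlim hI₁ hI₂ hI₃ gt₁ gt₂ gt₃)
        (Or.inr ENNReal.ofReal_ne_top)).liminf_eq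

/-- The sharp Young inequality on the line. -/
theorem youngBound_real {m₁ m₂ m₃ : ℝ} (h₁ : 0 < m₁) (h₂ : 0 < m₂) (h₃ : 0 < m₃)
    (hm : m₁ + m₂ + m₃ = 1) :
    YoungBound (volume : Measure ℝ) (1 - m₁) (1 - m₂) (1 - m₃)
      (ENNReal.ofReal (youngConst m₁ m₂ m₃)) := by
  intro f₁ f₂ f₃ hf₁ hf₂ hf₃
  have c₁ : 0 < 1 - m₁ := by linarith
  have c₂ : 0 < 1 - m₂ := by linarith
  have c₃ : 0 < 1 - m₃ := by linarith
  by_cases hz : ∫⁻ x, f₁ x = 0 ∨ ∫⁻ x, f₂ x = 0 ∨ ∫⁻ x, f₃ x = 0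
  · rw [lintegral_young_eq_zero c₁ c₂ c₃ hf₁ hf₂ hf₃ hz]
    exact zero_le
  push Not at hz
  by_cases hI : ∫⁻ x, f₁ x ≠ ⊤ ∧ ∫⁻ x, f₂ x ≠ ⊤ ∧ ∫⁻ x, f₃ x ≠ ⊤
  · exact lintegral_young_of_ne_top h₁ h₂ h₃ hm hf₁ hf₂ hf₃ hI.1 hI.2.1 hI.2.2
  have hC : ENNReal.ofReal (youngConst m₁ m₂ m₃) ≠ 0 := by
    simpa using youngConst_pos h₁ h₂ h₃ hm
  have hne : ∀ {A : ℝ≥0∞} {c : ℝ}, A ≠ 0 → 0 < c → A ^ c ≠ 0 := fun hA hc => by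
    simp [ENNReal.rpow_eq_zero_iff, hA, hc.le]
  have n₁ := hne hz.1 c₁
  have n₂ := hne hz.2.1 c₂
  have n₃ := hne hz.2.2 c₃
  -- No integral vanishes and at least one is infinite, so the right-hand side is infinite.
  refine le_of_le_of_eq le_top (Eq.symm ?_)
  rw [ENNReal.mul_eq_top]
  refine Or.inl ⟨hC, ?_⟩
  simp only [ENNReal.mul_eq_top, mul_ne_zero_iff, ENNReal.rpow_eq_top_iff_of_pos, c₁, c₂, c₃]
  tauto

/-! ### Tensorisation to Euclidean space -/

/-- Applying the inequality for `ν` on the fibres over fixed `x`, `y` and `x + y` leaves the fibre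
integrals raised to the same powers `cᵢ`. These form an admissible triple for `μ`, so the constants
multiply. -/
theorem YoungBound.prod {G H : Type*} [Add G] [Add H] [MeasurableSpace G] [MeasurableSpace H]
    [MeasurableAdd₂ G] [MeasurableAdd₂ H] {μ : Measure G} {ν : Measure H} [SFinite μ] [SFinite ν]
    {c₁ c₂ c₃ : ℝ} {C D : ℝ≥0∞} (hG : YoungBound μ c₁ c₂ c₃ C) (hH : YoungBound ν c₁ c₂ c₃ D)
    (hD : D ≠ ⊤) : YoungBound (μ.prod ν) c₁ c₂ c₃ (C * D) := by
  intro f₁ f₂ f₃ hf₁ hf₂ hf₃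
  have m₁ := hf₁.lintegral_prod_right' (ν := ν)
  have m₂ := hf₂.lintegral_prod_right' (ν := ν)
  have m₃ := hf₃.lintegral_prod_right' (ν := ν)
  have hadd : Measurable fun p : (G × H) × (G × H) => p.1 + p.2 :=
    ((measurable_fst.comp measurable_fst).add (measurable_fst.comp measurable_snd)).prodMk
      ((measurable_snd.comp measurable_fst).add (measurable_snd.comp measurable_snd))
  have hmeas : Measurable fun p : (G × H) × (G × H) =>
      f₁ p.1 ^ c₁ * f₂ p.2 ^ c₂ * f₃ (p.1 + p.2) ^ c₃ :=
    (((hf₁.comp measurable_fst).pow_const _).mul ((hf₂.comp measurable_snd).pow_const _)).mul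
      ((hf₃.comp hadd).pow_const _)
  calc _ = ∫⁻ x, ∫⁻ x', ∫⁻ y, ∫⁻ y', f₁ (x, x') ^ c₁ * f₂ (y, y') ^ c₂ *
        f₃ (x + y, x' + y') ^ c₃ ∂ν ∂μ ∂ν ∂μ := by
        rw [lintegral_prod _ hmeas.lintegral_prod_right'.aemeasurable]
        refine lintegral_congr fun x => lintegral_congr fun x' => ?_
        exact lintegral_prod _ (hmeas.comp measurable_prodMk_left).aemeasurable
    _ = ∫⁻ x, ∫⁻ y, ∫⁻ x', ∫⁻ y', f₁ (x, x') ^ c₁ * f₂ (y, y') ^ c₂ *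
        f₃ (x + y, x' + y') ^ c₃ ∂ν ∂ν ∂μ ∂μ := by
        refine lintegral_congr fun x => lintegral_lintegral_swap ?_
        have hmap : Measurable fun p : (H × G) × H => (((x, p.1.1), (p.1.2, p.2)) :
            (G × H) × (G × H)) := by fun_prop
        exact (hmeas.comp hmap).lintegral_prod_right'.aemeasurable
    _ ≤ ∫⁻ x, ∫⁻ y, D * ((∫⁻ x', f₁ (x, x') ∂ν) ^ c₁ * (∫⁻ x', f₂ (y, x') ∂ν) ^ c₂ *
        (∫⁻ x', f₃ (x + y, x') ∂ν) ^ c₃) ∂μ ∂μ := by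
        refine lintegral_mono fun x => lintegral_mono fun y => ?_
        exact hH (fun x' => f₁ (x, x')) (fun x' => f₂ (y, x')) (fun x' => f₃ (x + y, x'))
          (hf₁.comp measurable_prodMk_left) (hf₂.comp measurable_prodMk_left)
          (hf₃.comp measurable_prodMk_left)
    _ = D * ∫⁻ x, ∫⁻ y, ((∫⁻ x', f₁ (x, x') ∂ν) ^ c₁ * (∫⁻ x', f₂ (y, x') ∂ν) ^ c₂ *
        (∫⁻ x', f₃ (x + y, x') ∂ν) ^ c₃) ∂μ ∂μ := by
        rw [← lintegral_const_mul' _ _ hD]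
        exact lintegral_congr fun x => lintegral_const_mul' _ _ hD
    _ ≤ D * (C * ((∫⁻ x, ∫⁻ x', f₁ (x, x') ∂ν ∂μ) ^ c₁ * (∫⁻ x, ∫⁻ x', f₂ (x, x') ∂ν ∂μ) ^ c₂ *
        (∫⁻ x, ∫⁻ x', f₃ (x, x') ∂ν ∂μ) ^ c₃)) := by
        gcongr
        exact hG _ _ _ m₁ m₂ m₃
    _ = _ := by
        rw [lintegral_prod _ hf₁.aemeasurable, lintegral_prod _ hf₂.aemeasurable,
          lintegral_prod _ hf₃.aemeasurable]
        ring

theorem YoungBound.of_measurePreserving {G H : Type*} [Add G] [Add H] [MeasurableSpace G]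
    [MeasurableSpace H] {μ : Measure G} {ν : Measure H} {c₁ c₂ c₃ : ℝ} {C : ℝ≥0∞}
    (hG : YoungBound μ c₁ c₂ c₃ C) (e : G ≃ᵐ H) (he : MeasurePreserving e μ ν)
    (hadd : ∀ x y, e (x + y) = e x + e y) : YoungBound ν c₁ c₂ c₃ C := by
  intro f₁ f₂ f₃ hf₁ hf₂ hf₃
  have key := hG (f₁ ∘ e) (f₂ ∘ e) (f₃ ∘ e) (hf₁.comp e.measurable) (hf₂.comp e.measurable)
    (hf₃.comp e.measurable)
  have cov : ∀ f : H → ℝ≥0∞, ∫⁻ x, f (e x) ∂μ = ∫⁻ y, f y ∂ν :=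
    fun f => he.lintegral_comp_emb e.measurableEmbedding f
  simp only [Function.comp_apply, hadd, cov] at key
  rw [cov (fun x => ∫⁻ y, f₁ x ^ c₁ * f₂ (e y) ^ c₂ * f₃ (x + e y) ^ c₃ ∂μ)] at key
  refine le_trans (le_of_eq (lintegral_congr fun x => ?_)) key
  exact (cov fun y => f₁ x ^ c₁ * f₂ y ^ c₂ * f₃ (x + y) ^ c₃).symm

theorem YoungBound.pi {c₁ c₂ c₃ : ℝ} {C : ℝ≥0∞} (hC : C ≠ ⊤)
    (h : YoungBound (volume : Measure ℝ) c₁ c₂ c₃ C) (d : ℕ) :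
    YoungBound (volume : Measure (Fin d → ℝ)) c₁ c₂ c₃ (C ^ d) := by
  induction d with
  | zero =>
    intro f₁ f₂ f₃ _ _ _
    simp [volume_pi, Measure.pi_of_empty _ (0 : Fin 0 → ℝ)]
  | succ d ih =>
    rw [pow_succ']
    exact (h.prod ih (ENNReal.pow_ne_top hC)).of_measurePreserving
      (MeasurableEquiv.piFinSuccAbove (fun _ => ℝ) 0).symm
      (volume_preserving_piFinSuccAbove (fun _ => ℝ) 0).symm
      (fun x y => by
        rw [MeasurableEquiv.symm_apply_eq]
        ext <;> simp [MeasurableEquiv.piFinSuccAbove, Fin.insertNthEquiv, Fin.tail])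

/-- The sharp Young inequality on Euclidean space. -/
theorem youngBound_euclidean {m₁ m₂ m₃ : ℝ} (h₁ : 0 < m₁) (h₂ : 0 < m₂) (h₃ : 0 < m₃)
    (hm : m₁ + m₂ + m₃ = 1) (d : ℕ) :
    YoungBound (volume : Measure (Space d)) (1 - m₁) (1 - m₂) (1 - m₃)
      (ENNReal.ofReal (youngConst m₁ m₂ m₃) ^ d) :=
  ((youngBound_real h₁ h₂ h₃ hm).pi ENNReal.ofReal_ne_top d).of_measurePreserving
    (MeasurableEquiv.toLp 2 (Fin d → ℝ))
    (EuclideanSpace.volume_preserving_symm_measurableEquiv_toLp (Fin d)).symm (fun _ _ => rfl)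

/-! ### Weighted `L²` bounds for convolutions -/

variable {d : ℕ}

/-- The `L²` seminorm of a function with values in `[0, ∞]`. -/
noncomputable def l2 (u : Space d → ℝ≥0∞) : ℝ≥0∞ := (∫⁻ k, u k ^ (2 : ℝ)) ^ (1 / 2 : ℝ)

/-- Convolution of functions with values in `[0, ∞]`. -/
noncomputable def lconv (u v : Space d → ℝ≥0∞) (k : Space d) : ℝ≥0∞ := ∫⁻ h, u h * v (k - h)

lemma measurable_lconv {u v : Space d → ℝ≥0∞} (hu : Measurable u) (hv : Measurable v) :
    Measurable (lconv u v) :=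
  Measurable.lintegral_prod_right' (f := fun p : Space d × Space d => u p.2 * v (p.1 - p.2))
    (by fun_prop)

lemma lconv_comm (u v : Space d → ℝ≥0∞) : lconv u v = lconv v u := by
  ext k
  rw [lconv, lconv, ← lintegral_sub_left_eq_self _ k]
  simp [mul_comm]

lemma lconv_mono {u v u' v' : Space d → ℝ≥0∞} (hu : ∀ k, u k ≤ u' k) (hv : ∀ k, v k ≤ v' k)
    (k : Space d) : lconv u v k ≤ lconv u' v' k :=
  lintegral_mono fun h => mul_le_mul' (hu h) (hv (k - h))

lemma l2_mono {u v : Space d → ℝ≥0∞} (h : ∀ᵐ k, u k ≤ v k) : l2 u ≤ l2 v := by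
  unfold l2
  gcongr ?_ ^ _
  refine lintegral_mono_ae ?_
  filter_upwards [h] with k hk
  gcongr

lemma l2_add_le {u v : Space d → ℝ≥0∞} (hu : Measurable u) (hv : Measurable v) :
    l2 (fun k => u k + v k) ≤ l2 u + l2 v :=
  ENNReal.lintegral_Lp_add_le hu.aemeasurable hv.aemeasurable one_le_two

lemma l2_sum_le {ι : Type*} (s : Finset ι) {u : ι → Space d → ℝ≥0∞} (hu : ∀ i, Measurable (u i)) :
    l2 (fun k => ∑ i ∈ s, u i k) ≤ ∑ i ∈ s, l2 (u i) := by
  classical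
  induction s using Finset.induction_on with
  | empty => simp [l2]
  | insert i s hi ih =>
    simp only [Finset.sum_insert hi]
    exact (l2_add_le (hu i) (Finset.measurable_fun_sum _ fun j _ => hu j)).trans (by gcongr)

lemma l2_const_mul (c : ℝ≥0∞) {u : Space d → ℝ≥0∞} (hu : Measurable u) :
    l2 (fun k => c * u k) = c * l2 u := by
  unfold l2
  simp only [ENNReal.mul_rpow_of_nonneg _ _ (zero_le_two (α := ℝ))]
  rw [lintegral_const_mul _ (by fun_prop), ENNReal.mul_rpow_of_nonneg _ _ (by norm_num),
    ← ENNReal.rpow_mul]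
  norm_num

lemma lintegral_mul_le_l2 {u v : Space d → ℝ≥0∞} (hu : Measurable u) (hv : Measurable v) :
    ∫⁻ k, u k * v k ≤ l2 u * l2 v :=
  ENNReal.lintegral_mul_le_Lp_mul_Lq volume Real.HolderConjugate.two_two hu.aemeasurable
    hv.aemeasurable

/-- An `L²` bound by duality. -/
lemma l2_le_of_forall {u : Space d → ℝ≥0∞} (hu : Measurable u) {K : ℝ≥0∞}
    (h : ∀ z : Space d → ℝ≥0∞, Measurable z → ∫⁻ k, u k * z k ≤ K * l2 z) : l2 u ≤ K := by
  -- Testing with `u` itself would not allow cancellation of `l2 u` if that is infinite. Truncations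
  -- in space and height have finite norm and converge to `u`.
  set z : ℕ → Space d → ℝ≥0∞ := fun N =>
    (Metric.ball 0 N).indicator fun k => min (u k) N
  have hz : ∀ N, Measurable (z N) := fun N =>
    (hu.min measurable_const).indicator measurableSet_ball
  have hzu : ∀ N k, z N k ≤ u k := fun N k =>
    Set.indicator_le (fun k _ => min_le_left _ _) k
  have hzfin : ∀ N, ∫⁻ k, z N k ^ (2 : ℝ) ≠ ⊤ := by
    intro N
    refine ne_top_of_le_ne_top (b := ∫⁻ k in Metric.ball (0 : Space d) N, (N : ℝ≥0∞) ^ (2 : ℝ))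
      ?_ ?_
    · rw [setLIntegral_const]
      exact ENNReal.mul_ne_top (by simp) measure_ball_lt_top.ne
    · rw [← lintegral_indicator measurableSet_ball]
      refine lintegral_mono fun k => ?_
      simp only [z]
      by_cases hk : k ∈ Metric.ball (0 : Space d) N
      · simp only [Set.indicator_of_mem hk]
        gcongr
        exact min_le_right _ _
      · simp [Set.indicator_of_notMem hk]
  have hzK : ∀ N, l2 (z N) ≤ K := by
    intro N
    have h1 : ∫⁻ k, z N k ^ (2 : ℝ) ≤ K * l2 (z N) := by
      refine le_trans (lintegral_mono fun k => ?_) (h _ (hz N))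
      rw [show (2 : ℝ) = 1 + 1 by norm_num, ENNReal.rpow_add_of_nonneg _ _ zero_le_one zero_le_one,
        ENNReal.rpow_one]
      exact mul_le_mul_left (hzu N k) _
    have h2 : ∫⁻ k, z N k ^ (2 : ℝ) = l2 (z N) * l2 (z N) := by
      rw [l2, ← ENNReal.rpow_add_of_nonneg _ _ (by norm_num) (by norm_num)]
      norm_num
    rw [h2] at h1
    by_cases h0 : l2 (z N) = 0
    · simp [h0]
    · exact (ENNReal.mul_le_mul_iff_left h0
        (ENNReal.rpow_ne_top_of_nonneg (by norm_num) (hzfin N))).1 h1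
  have hlim : ∀ k, Tendsto (fun N => z N k ^ (2 : ℝ)) atTop (𝓝 (u k ^ (2 : ℝ))) := by
    intro k
    refine (ENNReal.continuous_rpow_const.tendsto _).comp ?_
    have h1 : Tendsto (fun N : ℕ => min (u k) (N : ℝ≥0∞)) atTop (𝓝 (u k)) := by
      simpa using tendsto_const_nhds.min ENNReal.tendsto_nat_nhds_top
    refine h1.congr' ?_
    obtain ⟨M, hM⟩ := exists_nat_gt ‖k‖
    filter_upwards [eventually_ge_atTop M] with N hN
    have : k ∈ Metric.ball (0 : Space d) N := by
      simpa using hM.trans_le (by exact_mod_cast hN)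
    simp only [z, Set.indicator_of_mem this]
  have hfat : ∫⁻ k, u k ^ (2 : ℝ) ≤ K ^ (2 : ℝ) := by
    calc ∫⁻ k, u k ^ (2 : ℝ) = ∫⁻ k, liminf (fun N => z N k ^ (2 : ℝ)) atTop :=
          lintegral_congr fun k => (hlim k).liminf_eq.symm
      _ ≤ liminf (fun N => ∫⁻ k, z N k ^ (2 : ℝ)) atTop :=
          lintegral_liminf_le fun N => (hz N).pow_const _
      _ ≤ liminf (fun _ => K ^ (2 : ℝ)) atTop := by
          refine liminf_le_liminf (Eventually.of_forall fun N => ?_)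
          have := ENNReal.rpow_le_rpow (hzK N) (zero_le_two (α := ℝ))
          rw [l2, ← ENNReal.rpow_mul] at this
          simpa using this
      _ = K ^ (2 : ℝ) := by simp
  calc l2 u ≤ (K ^ (2 : ℝ)) ^ (1 / 2 : ℝ) := ENNReal.rpow_le_rpow hfat (by norm_num)
    _ = K := by rw [← ENNReal.rpow_mul]; norm_num

lemma lintegral_lconv_mul {u v z : Space d → ℝ≥0∞} (hu : Measurable u) (hv : Measurable v)
    (hz : Measurable z) :
    ∫⁻ k, lconv u v k * z k = ∫⁻ x, ∫⁻ y, u x * v y * z (x + y) := by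
  have h1 : ∀ k, lconv u v k * z k = ∫⁻ x, u x * v (k - x) * z k := fun k =>
    (lintegral_mul_const _ (by fun_prop)).symm
  simp only [h1]
  rw [lintegral_lintegral_swap (by fun_prop)]
  refine lintegral_congr fun x => ?_
  rw [← lintegral_add_left_eq_self _ x]
  simp

/-- The square root of the factor `E(x) E(1/2 - x) / (E(1/2 + x) E(1 - x))`. -/
noncomputable def rootE (x : ℝ) : ℝ :=
  √(E x * E (1 / 2 - x) / (E (1 / 2 + x) * E (1 - x)))

lemma E_pos {x : ℝ} (hx : 0 ≤ x) : 0 < E x := by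
  rcases hx.eq_or_lt with rfl | hx
  · simp [E]
  · exact Real.rpow_pos_of_pos hx x

/-- For an `L²` target the third exponent is its own conjugate and contributes the factor one. -/
lemma youngConst_half {x : ℝ} (h0 : 0 < x) (h1 : x < 1 / 2) :
    youngConst x (1 / 2 - x) (1 / 2) = rootE x := by
  have e1 := E_pos h0.le
  have e2 := E_pos (show 0 ≤ 1 / 2 - x by linarith)
  have e3 := E_pos (show 0 ≤ 1 - x by linarith)
  have e4 := E_pos (show 0 ≤ 1 / 2 + x by linarith)
  have h2 : ((1 / 2 : ℝ) ^ (1 / 2 : ℝ) / (1 - 1 / 2) ^ (1 - 1 / 2 : ℝ)) = 1 := by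
    rw [show (1 - 1 / 2 : ℝ) = 1 / 2 by norm_num, div_self (by positivity)]
  rw [youngConst, rootE, h2, Real.sqrt_one, mul_one, show 1 - (1 / 2 - x) = 1 / 2 + x by ring]
  change √(E x / E (1 - x)) * √(E (1 / 2 - x) / E (1 / 2 + x)) = _
  rw [← Real.sqrt_mul (by positivity)]
  congr 1
  field_simp

/-- Hölder's inequality, with `R ^ s` measured in `L^(1/s)` (when `s > 0`), `A` in `L²` and their
product in `L^(1/c)`. -/
lemma lintegral_rpow_mul_le {R A : Space d → ℝ≥0∞} (hR : Measurable R) (hA : Measurable A)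
    {s c : ℝ} (hs : 0 ≤ s) (hc : s + 1 / 2 = c) :
    (∫⁻ k, (R k ^ s * A k) ^ (1 / c)) ^ c ≤ (∫⁻ k, R k) ^ s * l2 A := by
  have hc0 : 0 < c := by linarith
  have h := ENNReal.lintegral_mul_norm_pow_le (μ := volume) (f := R) (g := fun k => A k ^ (2 : ℝ))
    hR.aemeasurable (hA.pow_const _).aemeasurable (p := s / c) (q := 1 / 2 / c) (by positivity)
    (by positivity) (by rw [← add_div, hc, div_self hc0.ne'])
  have h2 : ∀ k, (R k ^ s * A k) ^ (1 / c) = R k ^ (s / c) * (A k ^ (2 : ℝ)) ^ (1 / 2 / c) := by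
    intro k
    rw [ENNReal.mul_rpow_of_nonneg _ _ (by positivity), ← ENNReal.rpow_mul, ← ENNReal.rpow_mul]
    congr 2 <;> ring
  simp only [h2]
  calc _ ≤ ((∫⁻ k, R k) ^ (s / c) * (∫⁻ k, A k ^ (2 : ℝ)) ^ (1 / 2 / c)) ^ c :=
        ENNReal.rpow_le_rpow h hc0.le
    _ = _ := by
        rw [ENNReal.mul_rpow_of_nonneg _ _ hc0.le, ← ENNReal.rpow_mul, ← ENNReal.rpow_mul, l2,
          div_mul_cancel₀ _ hc0.ne', div_mul_cancel₀ _ hc0.ne']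

/-- Sharp `L²` bound for a convolution of weighted functions, at interior exponents. -/
lemma l2_lconv_le_of_pos {R A B : Space d → ℝ≥0∞} (hR : Measurable R) (hA : Measurable A)
    (hB : Measurable B) {x : ℝ} (h0 : 0 < x) (h1 : x < 1 / 2) :
    l2 (lconv (fun k => R k ^ (1 / 2 - x) * A k) (fun k => R k ^ x * B k)) ≤
      ENNReal.ofReal (rootE x) ^ d * (∫⁻ k, R k) ^ (1 / 2 : ℝ) * l2 A * l2 B := by
  set U : Space d → ℝ≥0∞ := fun k => R k ^ (1 / 2 - x) * A k
  set V : Space d → ℝ≥0∞ := fun k => R k ^ x * B k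
  have hU : Measurable U := by fun_prop
  have hV : Measurable V := by fun_prop
  refine l2_le_of_forall (measurable_lconv hU hV) fun z hz => ?_
  rw [lintegral_lconv_mul hU hV hz]
  -- The reciprocal exponents of `U` and `V` are `1 - x` and `1/2 + x`. They sum to `3/2`, as
  -- Young's inequality with an `L²` target demands.
  have key := youngBound_euclidean h0 (show 0 < 1 / 2 - x by linarith) one_half_pos
    (by ring) d (fun k => U k ^ (1 / (1 - x))) (fun k => V k ^ (1 / (1 - (1 / 2 - x))))
    (fun k => z k ^ (1 / (1 - 1 / 2 : ℝ))) (by fun_prop) (by fun_prop) (by fun_prop)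
  have hcancel : ∀ (t : ℝ≥0∞) {c : ℝ}, 0 < c → (t ^ (1 / c)) ^ c = t := fun t c hc => by
    rw [← ENNReal.rpow_mul, one_div_mul_cancel hc.ne', ENNReal.rpow_one]
  simp only [hcancel _ (show 0 < 1 - x by linarith),
    hcancel _ (show 0 < 1 - (1 / 2 - x) by linarith), hcancel _ (show (0 : ℝ) < 1 - 1 / 2 by
    norm_num), youngConst_half h0 h1] at key
  refine key.trans ?_
  have b1 := lintegral_rpow_mul_le hR hA (s := 1 / 2 - x) (c := 1 - x) (by linarith) (by ring)
  have b2 := lintegral_rpow_mul_le hR hB (s := x) (c := 1 - (1 / 2 - x)) h0.le (by ring)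
  have b3 : (∫⁻ k, z k ^ (1 / (1 - 1 / 2 : ℝ))) ^ (1 - 1 / 2 : ℝ) = l2 z := by
    rw [l2]; norm_num
  rw [b3]
  calc _ ≤ ENNReal.ofReal (rootE x) ^ d * (((∫⁻ k, R k) ^ (1 / 2 - x) * l2 A) *
        ((∫⁻ k, R k) ^ x * l2 B) * l2 z) := by gcongr
    _ = ENNReal.ofReal (rootE x) ^ d * ((∫⁻ k, R k) ^ (1 / 2 - x) * (∫⁻ k, R k) ^ x) *
        l2 A * l2 B * l2 z := by ring
    _ = _ := by
        rw [← ENNReal.rpow_add_of_nonneg _ _ (by linarith) h0.le, sub_add_cancel]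

/-- The endpoint `L¹ * L² → L²`, not reached by the transport argument, which needs all `mᵢ`
positive. Cauchy–Schwarz in `y`, with translation invariance of the norm of `z`, suffices. -/
lemma l2_lconv_le_of_zero {R A B : Space d → ℝ≥0∞} (hR : Measurable R) (hA : Measurable A)
    (hB : Measurable B) :
    l2 (lconv (fun k => R k ^ (1 / 2 : ℝ) * A k) B) ≤
      (∫⁻ k, R k) ^ (1 / 2 : ℝ) * l2 A * l2 B := by
  set U : Space d → ℝ≥0∞ := fun k => R k ^ (1 / 2 : ℝ) * A k
  have hU : Measurable U := by fun_prop
  refine l2_le_of_forall (measurable_lconv hU hB) fun z hz => ?_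
  rw [lintegral_lconv_mul hU hB hz]
  have hinner : ∀ x, ∫⁻ y, U x * B y * z (x + y) ≤ U x * (l2 B * l2 z) := by
    intro x
    simp only [mul_assoc]
    rw [lintegral_const_mul _ (by fun_prop)]
    gcongr
    refine (lintegral_mul_le_l2 hB (v := fun y => z (x + y)) (by fun_prop)).trans_eq ?_
    congr 1
    unfold l2
    rw [lintegral_add_left_eq_self (fun y => z y ^ (2 : ℝ)) x]
  have hU1 : ∫⁻ x, U x ≤ (∫⁻ k, R k) ^ (1 / 2 : ℝ) * l2 A := by
    simpa [U] using lintegral_rpow_mul_le hR hA (s := 1 / 2) (c := 1) (by norm_num) (by norm_num)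
  calc _ ≤ ∫⁻ x, U x * (l2 B * l2 z) := lintegral_mono hinner
    _ = (∫⁻ x, U x) * (l2 B * l2 z) := lintegral_mul_const _ hU
    _ ≤ ((∫⁻ k, R k) ^ (1 / 2 : ℝ) * l2 A) * (l2 B * l2 z) := by gcongr
    _ = _ := by ring

/-- Sharp `L²` bound for a convolution of weighted functions. -/
theorem l2_lconv_le {R A B : Space d → ℝ≥0∞} (hR : Measurable R) (hA : Measurable A)
    (hB : Measurable B) {x : ℝ} (h0 : 0 ≤ x) (h1 : x ≤ 1 / 2) :
    l2 (lconv (fun k => R k ^ (1 / 2 - x) * A k) (fun k => R k ^ x * B k)) ≤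
      ENNReal.ofReal (rootE x) ^ d * (∫⁻ k, R k) ^ (1 / 2 : ℝ) * l2 A * l2 B := by
  have hhalf : E (1 / 2) ≠ 0 := (E_pos (by norm_num)).ne'
  rcases h0.eq_or_lt with rfl | h0
  · have hE : rootE 0 = 1 := by
      rw [rootE, show E 0 = 1 by simp [E], show E (1 - 0) = 1 by simp [E]]
      simp only [sub_zero, add_zero, one_mul, mul_one, div_self hhalf, Real.sqrt_one]
    rw [hE]
    simpa using l2_lconv_le_of_zero hR hA hB
  rcases h1.eq_or_lt with rfl | h1
  · have hE : rootE (1 / 2) = 1 := by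
      rw [rootE, show E (1 / 2 - 1 / 2) = 1 by simp [E],
        show E (1 / 2 + 1 / 2) = 1 by norm_num [E], show (1 - 1 / 2 : ℝ) = 1 / 2 by norm_num]
      simp only [one_mul, mul_one, div_self hhalf, Real.sqrt_one]
    rw [hE, lconv_comm]
    have := l2_lconv_le_of_zero hR hB hA
    simp only [sub_self, ENNReal.rpow_zero, one_mul, ENNReal.ofReal_one, one_pow]
    rwa [mul_right_comm] at this
  · exact l2_lconv_le_of_pos hR hA hB h0 h1

/-! ### Fourier transforms of products -/

lemma continuous_neg_innerₗ :
    Continuous fun p : Space d × Space d => (-innerₗ (Space d)) p.1 p.2 :=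
  (continuous_inner (𝕜 := ℝ) (E := Space d)).neg

lemma continuous_fourierInv {F : Space d → ℂ} (hF : Integrable F) : Continuous (𝓕⁻ F) :=
  VectorFourier.fourierIntegral_continuous (L := -innerₗ (Space d)) Real.continuous_fourierChar
    continuous_neg_innerₗ hF

/-- The `L²` inverse Fourier transform is given by the integral on integrable functions. -/
theorem fourierInv_toLp_ae_eq {F : Space d → ℂ} (hF : Integrable F) (hF2 : MemLp F 2) :
    (𝓕⁻ (hF2.toLp F) : L2 d) =ᵐ[volume] 𝓕⁻ F := by
  -- Tested against a smooth compactly supported function, the transform moves onto the test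
  -- function by compatibility with tempered distributions, and back onto `F` by Fubini.
  refine ae_eq_of_integral_contDiff_smul_eq
    ((Lp.memLp _).locallyIntegrable (by norm_num)) (continuous_fourierInv hF).locallyIntegrable ?_
  intro g hg hgc
  have hgc' : HasCompactSupport fun x => (g x : ℂ) := hgc.comp_left Complex.ofReal_zero
  have hg' : ContDiff ℝ (⊤ : ℕ∞) fun x => (g x : ℂ) := Complex.ofRealCLM.contDiff.comp hg
  set φ : SchwartzMap (Space d) ℂ := hgc'.toSchwartzMap hg' with hφ
  have hφg : ∀ x, φ x = (g x : ℂ) := fun x => rfl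
  have h1 := congrArg (fun T => T φ) (Lp.fourierInv_toTemperedDistribution_eq (hF2.toLp F))
  simp only [TemperedDistribution.fourierInv_apply, Lp.toTemperedDistribution_apply] at h1
  calc ∫ x, g x • (𝓕⁻ (hF2.toLp F) : L2 d) x = ∫ x, φ x • (𝓕⁻ (hF2.toLp F) : L2 d) x := by
        simp only [hφg, Complex.real_smul, smul_eq_mul]
    _ = ∫ x, (𝓕⁻ φ) x • (hF2.toLp F) x := h1.symm
    _ = ∫ x, (𝓕⁻ (φ : Space d → ℂ)) x • F x := by
        refine integral_congr_ae ?_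
        filter_upwards [hF2.coeFn_toLp] with x hx
        rw [hx, SchwartzMap.fourierInv_coe]
    _ = ∫ x, φ x • 𝓕⁻ F x := by
        have := VectorFourier.integral_fourierIntegral_smul_eq_flip (L := -innerₗ (Space d))
          Real.continuous_fourierChar continuous_neg_innerₗ (φ.integrable (μ := volume)) hF
        have hflip : (-innerₗ (Space d)).flip = -innerₗ (Space d) := by
          refine LinearMap.ext fun x => LinearMap.ext fun y => ?_
          simp [real_inner_comm]
        rw [hflip] at this
        exact this
    _ = ∫ x, g x • 𝓕⁻ F x := by
        simp only [hφg, Complex.real_smul, smul_eq_mul]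

lemma norm_fourierInv_le (F : Space d → ℂ) (x : Space d) : ‖𝓕⁻ F x‖ ≤ ∫ k, ‖F k‖ :=
  VectorFourier.norm_fourierIntegral_le_integral_norm _ _ _ _ _

open scoped Convolution in
lemma enorm_convolution_le (F G : Space d → ℂ) (k : Space d) :
    ‖(F ⋆[ContinuousLinearMap.mul ℂ ℂ] G) k‖ₑ ≤ lconv (fun h => ‖F h‖ₑ) (fun h => ‖G h‖ₑ) k := by
  refine (enorm_integral_le_lintegral_enorm _).trans_eq ?_
  simp [lconv]

lemma eLpNorm_two_eq_l2 (F : Space d → ℂ) : eLpNorm F 2 volume = l2 fun k => ‖F k‖ₑ := by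
  rw [eLpNorm_eq_lintegral_rpow_enorm_toReal two_ne_zero ENNReal.ofNat_ne_top]
  simp [l2]

/-- The endpoint bound with `R = u` and `A = u ^ (1/2)`. -/
lemma l2_lconv_le_lintegral_mul {u v : Space d → ℝ≥0∞} (hu : Measurable u) (hv : Measurable v) :
    l2 (lconv u v) ≤ (∫⁻ k, u k) * l2 v := by
  have h := l2_lconv_le_of_zero hu (hu.pow_const (1 / 2 : ℝ)) hv
  have e1 : ∀ k, u k ^ (1 / 2 : ℝ) * u k ^ (1 / 2 : ℝ) = u k := fun k => by
    rw [← ENNReal.rpow_add_of_nonneg _ _ (by norm_num) (by norm_num)]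
    norm_num
  have e2 : l2 (fun k => u k ^ (1 / 2 : ℝ)) = (∫⁻ k, u k) ^ (1 / 2 : ℝ) := by
    unfold l2
    simp only [← ENNReal.rpow_mul]
    norm_num
  simp only [e1, e2] at h
  rwa [← ENNReal.rpow_add_of_nonneg _ _ (by norm_num) (by norm_num), add_halves,
    ENNReal.rpow_one] at h

open scoped Convolution in
/-- The Fourier transform of a product is bounded by the convolution of the Fourier transforms,
for integrable Fourier transforms. -/
lemma enorm_fourier_mul_le_of_integrable {F G : Space d → ℂ} (hFm : StronglyMeasurable F)
    (hGm : StronglyMeasurable G) (hF : Integrable F)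
    (hG : Integrable G) (hG2 : MemLp G 2) {h : L2 d}
    (hh : h =ᵐ[volume] fun x => 𝓕⁻ F x * 𝓕⁻ G x) :
    ∀ᵐ k, ‖(𝓕 h : L2 d) k‖ₑ ≤ lconv (fun k => ‖F k‖ₑ) (fun k => ‖G k‖ₑ) k := by
  set P : Space d → ℂ := F ⋆[ContinuousLinearMap.mul ℂ ℂ] G
  have hP : Integrable P := hF.integrable_convolution _ hG
  have hP2 : MemLp P 2 := by
    refine ⟨hP.aestronglyMeasurable, ?_⟩
    rw [eLpNorm_two_eq_l2]
    refine (l2_mono (Eventually.of_forall (enorm_convolution_le F G))).trans_lt ?_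
    refine (l2_lconv_le_lintegral_mul hFm.enorm hGm.enorm).trans_lt (ENNReal.mul_lt_top hF.2 ?_)
    rw [← eLpNorm_two_eq_l2]
    exact hG2.2
  have hinv : (𝓕⁻ (hP2.toLp P) : L2 d) = h := by
    refine Lp.ext ?_
    filter_upwards [fourierInv_toLp_ae_eq hP hP2, hh] with x h1 h2
    rw [h1, h2, Real.fourierInv_eq_fourier_neg, Real.fourier_mul_convolution_eq hF hG,
      Real.fourierInv_eq_fourier_neg, Real.fourierInv_eq_fourier_neg]
  have hfour : (𝓕 h : L2 d) = hP2.toLp P := by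
    rw [← hinv, FourierTransform.fourier_fourierInv_eq]
  rw [hfour]
  filter_upwards [hP2.coeFn_toLp] with k hk
  rw [hk]
  exact enorm_convolution_le F G k

/-- Truncation of a square integrable function to balls. -/
lemma tendsto_eLpNorm_indicator_ball {G : Space d → ℂ} (hG : MemLp G 2) :
    Tendsto (fun N : ℕ => eLpNorm ((Metric.ball 0 (N : ℝ)).indicator G - G) 2 volume) atTop
      (𝓝 0) := by
  have hmeas : ∀ N : ℕ, AEStronglyMeasurable ((Metric.ball 0 (N : ℝ)).indicator G - G) :=
    fun N => (hG.1.indicator measurableSet_ball).sub hG.1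
  simp only [eLpNorm_two_eq_l2, l2]
  have h0 : (0 : ℝ≥0∞) = (∫⁻ _ : Space d, 0) ^ (1 / 2 : ℝ) := by simp
  rw [h0]
  refine (ENNReal.continuous_rpow_const.tendsto _).comp ?_
  refine tendsto_lintegral_of_dominated_convergence' (fun k => ‖G k‖ₑ ^ (2 : ℝ))
    (fun N => (hmeas N).enorm.pow_const _) (fun N => Eventually.of_forall fun k => ?_) ?_ ?_
  · by_cases hk : k ∈ Metric.ball (0 : Space d) (N : ℝ)
    · simp [Set.indicator_of_mem hk]
    · simp [Set.indicator_of_notMem hk]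
  · have := lintegral_rpow_enorm_lt_top_of_eLpNorm_lt_top two_ne_zero ENNReal.ofNat_ne_top hG.2
    simpa using this.ne
  · refine Eventually.of_forall fun k => tendsto_const_nhds.congr' ?_
    obtain ⟨M, hM⟩ := exists_nat_gt ‖k‖
    filter_upwards [eventually_ge_atTop M] with N hN
    have : k ∈ Metric.ball (0 : Space d) N := by
      simpa using hM.trans_le (by exact_mod_cast hN)
    simp [Set.indicator_of_mem this]

/-- If the Fourier transform of `f` is integrable then multiplication by `f` acts on `L²`, and the
Fourier transform of a product is bounded by the convolution of the Fourier transforms. -/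
theorem exists_mul_enorm_fourier_le {f : L2 d} (hf : Integrable (𝓕 f : L2 d)) (g : L2 d) :
    ∃ h : L2 d, (∀ᵐ x, h x = f x * g x) ∧
      ∀ᵐ k, ‖(𝓕 h : L2 d) k‖ₑ ≤
        lconv (fun k => ‖(𝓕 f : L2 d) k‖ₑ) (fun k => ‖(𝓕 g : L2 d) k‖ₑ) k := by
  set F : Space d → ℂ := ⇑(𝓕 f : L2 d) with hFdef
  set G : Space d → ℂ := ⇑(𝓕 g : L2 d) with hGdef
  have hF2 : MemLp F 2 := Lp.memLp _
  have hG2 : MemLp G 2 := Lp.memLp _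
  have hinvF : hF2.toLp F = (𝓕 f : L2 d) := Lp.toLp_coeFn _ _
  have hinvG : hG2.toLp G = (𝓕 g : L2 d) := Lp.toLp_coeFn _ _
  have hfF : f =ᵐ[volume] 𝓕⁻ F := by
    have := fourierInv_toLp_ae_eq hf hF2
    rwa [hinvF, FourierTransform.fourierInv_fourier_eq] at this
  -- As the inverse transform of an integrable function `f` is bounded, so multiplication by it is
  -- continuous on `L²`.
  have hfbdd : MemLp f ⊤ volume := by
    refine memLp_top_of_bound (Lp.aestronglyMeasurable f) (∫ k, ‖F k‖) ?_
    filter_upwards [hfF] with x hx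
    rw [hx]
    exact norm_fourierInv_le F x
  set fb : Lp ℂ ⊤ (volume : Measure (Space d)) := hfbdd.toLp f
  have hmul : ∀ v : L2 d, (fb • v : L2 d) =ᵐ[volume] fun x => f x * v x := by
    intro v
    filter_upwards [Lp.coeFn_lpSMul (r := 2) fb v, hfbdd.coeFn_toLp] with x h1 h2
    rw [h1, Pi.smul_apply', h2, smul_eq_mul]
  refine ⟨fb • g, hmul g, ?_⟩
  -- Truncation to balls makes the transform of `g` integrable and can only decrease the convolution
  -- of the moduli. The bound then passes to the `L²` limit along an almost everywhere convergent
  -- subsequence.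
  set GN : ℕ → Space d → ℂ := fun N => (Metric.ball 0 (N : ℝ)).indicator G
  have hGNm : ∀ N, StronglyMeasurable (GN N) := fun N =>
    (Lp.stronglyMeasurable _).indicator measurableSet_ball
  have hGN2 : ∀ N, MemLp (GN N) 2 := fun N => hG2.indicator measurableSet_ball
  have hGN1 : ∀ N, Integrable (GN N) := fun N => by
    rw [integrable_indicator_iff measurableSet_ball]
    have : IsFiniteMeasure (volume.restrict (Metric.ball (0 : Space d) N)) :=
      ⟨by simpa using measure_ball_lt_top⟩
    exact (hG2.restrict _).integrable one_le_two
  set gN : ℕ → L2 d := fun N => 𝓕⁻ ((hGN2 N).toLp (GN N))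
  have hbound : ∀ N, ∀ᵐ k, ‖(𝓕 (fb • gN N : L2 d) : L2 d) k‖ₑ ≤
      lconv (fun k => ‖F k‖ₑ) (fun k => ‖G k‖ₑ) k := by
    intro N
    have hh : (fb • gN N : L2 d) =ᵐ[volume] fun x => 𝓕⁻ F x * 𝓕⁻ (GN N) x := by
      filter_upwards [hmul (gN N), hfF, fourierInv_toLp_ae_eq (hGN1 N) (hGN2 N)] with x h1 h2 h3
      rw [h1, h2, h3]
    filter_upwards [enorm_fourier_mul_le_of_integrable (Lp.stronglyMeasurable _) (hGNm N) hf
      (hGN1 N) (hGN2 N) hh] with k hk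
    refine hk.trans (lconv_mono (fun _ => le_rfl) (fun k => ?_) k)
    exact enorm_indicator_le_enorm_self _ _
  have hlim : Tendsto (fun N => (𝓕 (fb • gN N : L2 d) : L2 d)) atTop
      (𝓝 (𝓕 (fb • g : L2 d) : L2 d)) := by
    have h1 : Tendsto (fun N => (hGN2 N).toLp (GN N)) atTop (𝓝 (𝓕 g : L2 d)) := by
      rw [← hinvG, Lp.tendsto_Lp_iff_tendsto_eLpNorm'']
      exact tendsto_eLpNorm_indicator_ball hG2
    have h2 : Tendsto gN atTop (𝓝 g) := by
      have := ((Lp.fourierTransformₗᵢ (Space d) ℂ).symm.continuous.tendsto _).comp h1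
      have e : (Lp.fourierTransformₗᵢ (Space d) ℂ).symm (𝓕 g : L2 d) = g :=
        (Lp.fourierTransformₗᵢ (Space d) ℂ).symm_apply_apply g
      rwa [e] at this
    refine ((Lp.fourierTransformₗᵢ (Space d) ℂ).continuous.tendsto _).comp ?_
    rw [tendsto_iff_norm_sub_tendsto_zero] at h2 ⊢
    have h3 := h2.const_mul ‖fb‖
    rw [mul_zero] at h3
    refine squeeze_zero (fun _ => norm_nonneg _) (fun N => ?_) h3
    have : (fb • gN N : L2 d) - fb • g = fb • (gN N - g) := by
      rw [sub_eq_add_neg, sub_eq_add_neg, Lp.add_smul, Lp.smul_neg]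
    rw [this]
    exact Lp.norm_smul_le _ _
  obtain ⟨ns, -, hns⟩ := (tendstoInMeasure_of_tendsto_Lp hlim).exists_seq_tendsto_ae
  filter_upwards [hns, ae_all_iff.2 hbound] with k h1 h2
  exact le_of_tendsto h1.enorm (Eventually.of_forall fun n => h2 (ns n))

/-! ### The Sobolev weight, its integral and the constant `S` -/

lemma lintegral_ofReal_of_integral_eq {α : Type*} [MeasurableSpace α] {μ : Measure α} {f : α → ℝ}
    {I : ℝ} (h : ∫ x, f x ∂μ = I) (hI : I ≠ 0) (hf : 0 ≤ᵐ[μ] f) :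
    ∫⁻ x, ENNReal.ofReal (f x) ∂μ = ENNReal.ofReal I := by
  rw [← h, ofReal_integral_eq_lintegral_ofReal (Integrable.of_integral_ne_zero (h ▸ hI)) hf]

lemma lintegral_rpow_mul_exp {b r : ℝ} (hb : 0 < b) (hr : 0 < r) :
    ∫⁻ t in Set.Ioi (0 : ℝ), ENNReal.ofReal (t ^ (b - 1) * Real.exp (-(r * t))) =
      ENNReal.ofReal ((1 / r) ^ b * Real.Gamma b) := by
  have := Real.Gamma_pos_of_pos hb
  refine lintegral_ofReal_of_integral_eq (Real.integral_rpow_mul_exp_neg_mul_Ioi hb hr)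
    (by positivity) ?_
  filter_upwards [ae_restrict_mem measurableSet_Ioi] with t ht
  have : 0 < t := ht
  positivity

/-- The integral of `(1 + |k|²)^(-a)` over `ℝ^d`. -/
theorem lintegral_one_add_norm_sq_rpow_neg {a : ℝ} (ha : (d : ℝ) / 2 < a) :
    ∫⁻ k : Space d, ENNReal.ofReal ((1 + ‖k‖ ^ 2) ^ (-a)) =
      ENNReal.ofReal (Real.pi ^ ((d : ℝ) / 2) * (Real.Gamma (a - d / 2) / Real.Gamma a)) := by
  have hd0 : (0 : ℝ) ≤ d / 2 := by positivity
  have ha0 : 0 < a := hd0.trans_lt ha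
  have hG := Real.Gamma_pos_of_pos ha0
  have hG' := Real.Gamma_pos_of_pos (sub_pos.2 ha)
  have hgauss : ∀ t : ℝ, 0 < t → ∫⁻ k : Space d, ENNReal.ofReal (Real.exp (-t * ‖k‖ ^ 2)) =
      ENNReal.ofReal ((Real.pi / t) ^ ((d : ℝ) / 2)) := by
    intro t ht
    refine lintegral_ofReal_of_integral_eq ?_ (by positivity)
      (Eventually.of_forall fun k => (Real.exp_pos _).le)
    simpa using GaussianFourier.integral_rexp_neg_mul_sq_norm (V := Space d) ht
  -- Writing the power as a Gamma integral in `t` turns the integral over `k` into a Gaussian one.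
  have hpt : ∀ k : Space d, ENNReal.ofReal ((1 + ‖k‖ ^ 2) ^ (-a)) =
      ENNReal.ofReal (Real.Gamma a)⁻¹ * ∫⁻ t in Set.Ioi (0 : ℝ),
        ENNReal.ofReal (t ^ (a - 1) * Real.exp (-((1 + ‖k‖ ^ 2) * t))) := by
    intro k
    rw [lintegral_rpow_mul_exp ha0 (by positivity), ← ENNReal.ofReal_mul (by positivity)]
    congr 1
    rw [one_div, Real.inv_rpow (by positivity), Real.rpow_neg (by positivity)]
    field_simp
  simp only [hpt]
  rw [lintegral_const_mul' _ _ ENNReal.ofReal_ne_top, lintegral_lintegral_swap]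
  swap
  · have : Measurable fun p : Space d × ℝ =>
        ENNReal.ofReal (p.2 ^ (a - 1) * Real.exp (-((1 + ‖p.1‖ ^ 2) * p.2))) := by fun_prop
    exact this.aemeasurable
  have hinner : ∀ t ∈ Set.Ioi (0 : ℝ), ∫⁻ k : Space d,
      ENNReal.ofReal (t ^ (a - 1) * Real.exp (-((1 + ‖k‖ ^ 2) * t))) =
      ENNReal.ofReal (Real.pi ^ ((d : ℝ) / 2)) *
        ENNReal.ofReal (t ^ (a - d / 2 - 1) * Real.exp (-(1 * t))) := by
    intro t ht
    have ht : 0 < t := ht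
    have h1 : ∀ k : Space d, ENNReal.ofReal (t ^ (a - 1) * Real.exp (-((1 + ‖k‖ ^ 2) * t))) =
        ENNReal.ofReal (t ^ (a - 1) * Real.exp (-t)) *
          ENNReal.ofReal (Real.exp (-t * ‖k‖ ^ 2)) := by
      intro k
      rw [← ENNReal.ofReal_mul (by positivity), mul_assoc, ← Real.exp_add]
      congr 3
      ring
    simp only [h1]
    rw [lintegral_const_mul' _ _ ENNReal.ofReal_ne_top, hgauss t ht,
      ← ENNReal.ofReal_mul (by positivity), ← ENNReal.ofReal_mul (by positivity)]
    congr 1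
    rw [Real.div_rpow Real.pi_pos.le ht.le, show a - d / 2 - 1 = a - 1 - d / 2 by ring,
      Real.rpow_sub ht (a - 1), one_mul]
    ring
  rw [setLIntegral_congr_fun measurableSet_Ioi hinner,
    lintegral_const_mul' _ _ ENNReal.ofReal_ne_top,
    lintegral_rpow_mul_exp (sub_pos.2 ha) one_pos, ← ENNReal.ofReal_mul (by positivity),
    ← ENNReal.ofReal_mul (by positivity)]
  congr 1
  simp only [div_one, Real.one_rpow, one_mul]
  ring

/-- The weight `√(1 + |k|²)^n`. -/
noncomputable def wt (n : ℝ) (k : Space d) : ℝ≥0∞ := ENNReal.ofReal (√(1 + ‖k‖ ^ 2) ^ n)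

@[fun_prop]
lemma measurable_wt (n : ℝ) : Measurable (wt n : Space d → ℝ≥0∞) := by
  unfold wt
  fun_prop

lemma sqrt_one_add_pos (k : Space d) : 0 < √(1 + ‖k‖ ^ 2) := by positivity

lemma one_le_sqrt_one_add (k : Space d) : 1 ≤ √(1 + ‖k‖ ^ 2) := by
  rw [Real.one_le_sqrt]
  nlinarith [sq_nonneg ‖k‖]

lemma wt_add (m n : ℝ) (k : Space d) : wt (m + n) k = wt m k * wt n k := by
  rw [wt, wt, wt, ← ENNReal.ofReal_mul (by positivity), ← Real.rpow_add (sqrt_one_add_pos k)]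

lemma wt_rpow (m s : ℝ) (k : Space d) : wt m k ^ s = wt (m * s) k := by
  rw [wt, wt, ENNReal.ofReal_rpow_of_pos (Real.rpow_pos_of_pos (sqrt_one_add_pos k) _),
    ← Real.rpow_mul (sqrt_one_add_pos k).le]

lemma wt_mono {m n : ℝ} (h : m ≤ n) (k : Space d) : wt m k ≤ wt n k :=
  ENNReal.ofReal_le_ofReal (Real.rpow_le_rpow_of_exponent_le (one_le_sqrt_one_add k) h)

lemma lintegral_wt {a : ℝ} (ha : (d : ℝ) / 2 < a) :
    ∫⁻ k : Space d, wt (-(2 * a)) k =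
      ENNReal.ofReal (Real.pi ^ ((d : ℝ) / 2) * (Real.Gamma (a - d / 2) / Real.Gamma a)) := by
  rw [← lintegral_one_add_norm_sq_rpow_neg ha]
  refine lintegral_congr fun k => ?_
  rw [wt, Real.sqrt_eq_rpow, ← Real.rpow_mul (by positivity)]
  congr 2
  ring

lemma S_pos {a : ℝ} (ha : (d : ℝ) / 2 < a) : 0 < S a d := by
  have hd0 : (0 : ℝ) ≤ d / 2 := by positivity
  have hG := Real.Gamma_pos_of_pos (hd0.trans_lt ha)
  have hG' := Real.Gamma_pos_of_pos (sub_pos.2 ha)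
  have := Real.pi_pos
  unfold S
  positivity

/-- The left factor is the one that appears in the transform of a product; combined with `π^(d/4)`
from the weight integral it becomes `(4π)^(-d/4)`. -/
lemma ofReal_S {a : ℝ} (ha : (d : ℝ) / 2 < a) :
    ENNReal.ofReal ((2 * Real.pi) ^ (-(d : ℝ) / 2)) *
      (∫⁻ k : Space d, wt (-(2 * a)) k) ^ (1 / 2 : ℝ) = ENNReal.ofReal (S a d) := by
  have hd0 : (0 : ℝ) ≤ d / 2 := by positivity
  have hG := Real.Gamma_pos_of_pos (hd0.trans_lt ha)
  have hG' := Real.Gamma_pos_of_pos (sub_pos.2 ha)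
  have hπ := Real.pi_pos
  rw [lintegral_wt ha, ENNReal.ofReal_rpow_of_pos (by positivity),
    ← ENNReal.ofReal_mul (by positivity), S]
  congr 1
  have h1 : (Real.pi ^ ((d : ℝ) / 2) * (Real.Gamma (a - d / 2) / Real.Gamma a)) ^ (1 / 2 : ℝ) =
      Real.pi ^ ((d : ℝ) / 4) * √(Real.Gamma (a - d / 2) / Real.Gamma a) := by
    rw [Real.mul_rpow (by positivity) (by positivity), ← Real.rpow_mul hπ.le, Real.sqrt_eq_rpow]
    congr 2
    ring
  have h2 : 1 / (4 * Real.pi) ^ ((d : ℝ) / 4) =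
      (2 * Real.pi) ^ (-(d : ℝ) / 2) * Real.pi ^ ((d : ℝ) / 4) := by
    rw [one_div, ← Real.rpow_neg (by positivity), show (4 : ℝ) * Real.pi = 2 * 2 * Real.pi by ring,
      Real.mul_rpow (by positivity) hπ.le, Real.mul_rpow two_pos.le two_pos.le,
      Real.mul_rpow two_pos.le hπ.le, ← Real.rpow_add two_pos, mul_assoc, ← Real.rpow_add hπ]
    congr 2 <;> ring
  rw [h1, h2, mul_assoc]

/-! ### The Young factors in terms of Sobolev orders -/

lemma rootE_pos {x : ℝ} (h0 : 0 ≤ x) (h1 : x ≤ 1 / 2) : 0 < rootE x := by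
  have e1 := E_pos h0
  have e2 := E_pos (show 0 ≤ 1 / 2 - x by linarith)
  have e3 := E_pos (show 0 ≤ 1 - x by linarith)
  have e4 := E_pos (show 0 ≤ 1 / 2 + x by linarith)
  unfold rootE
  positivity

lemma E₃_eq_rootE_pow {l a : ℝ} (ha : 0 < a) (h0 : 0 ≤ l) (h1 : l ≤ a) :
    E₃ l a d = rootE (l / (2 * a)) ^ d := by
  have hx0 : 0 ≤ l / (2 * a) := by positivity
  have hx1 : l / (2 * a) ≤ 1 / 2 := by rw [div_le_div_iff₀ (by positivity) two_pos]; linarith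
  have e1 := E_pos hx0
  have e2 := E_pos (show 0 ≤ 1 / 2 - l / (2 * a) by linarith)
  have e3 := E_pos (show 0 ≤ 1 - l / (2 * a) by linarith)
  have e4 := E_pos (show 0 ≤ 1 / 2 + l / (2 * a) by linarith)
  rw [E₃, rootE, Real.sqrt_eq_rpow, ← Real.rpow_natCast, ← Real.rpow_mul (by positivity)]
  congr 1
  ring

lemma E₃_nonneg {l a : ℝ} (ha : 0 < a) (h0 : 0 ≤ l) (h1 : l ≤ a) : 0 ≤ E₃ l a d := by
  rw [E₃_eq_rootE_pow ha h0 h1]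
  have : rootE (l / (2 * a)) ≥ 0 := Real.sqrt_nonneg _
  positivity

/-- The reflection `x ↦ 1/2 - x` swaps the two factors of the numerator and those of the
denominator. It serves the upper end of the lattice. -/
lemma E₃_symm {l a : ℝ} (ha : 0 < a) : E₃ (a - l) a d = E₃ l a d := by
  have e : (a - l) / (2 * a) = 1 / 2 - l / (2 * a) := by field_simp
  rw [E₃, E₃, e]
  congr 1
  rw [show 1 / 2 - (1 / 2 - l / (2 * a)) = l / (2 * a) by ring,
    show 1 / 2 + (1 / 2 - l / (2 * a)) = 1 - l / (2 * a) by ring,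
    show 1 - (1 / 2 - l / (2 * a)) = 1 / 2 + l / (2 * a) by ring,
    mul_comm (E (1 / 2 - l / (2 * a))), mul_comm (E (1 - l / (2 * a)))]

/-- At `x = 1/4` the quotient is `(E (1/4) / E (3/4)) ^ 2`, whose square is `(1/4) / (27/64) =
16/27`. -/
lemma E₃_half {a : ℝ} (ha : 0 < a) : E₃ (a / 2) a d = (16 / 27 : ℝ) ^ ((d : ℝ) / 4) := by
  have e : a / 2 / (2 * a) = 1 / 4 := by field_simp; norm_num
  have h14 : E (1 / 4) ^ 2 = 1 / 2 := by
    rw [E, ← Real.rpow_natCast, ← Real.rpow_mul (by norm_num),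
      show (1 / 4 : ℝ) = (1 / 2) ^ (2 : ℝ) by norm_num, ← Real.rpow_mul (by norm_num)]
    norm_num
  have h34 : E (3 / 4) ^ 4 = 27 / 64 := by
    rw [E, ← Real.rpow_natCast, ← Real.rpow_mul (by norm_num)]
    norm_num
  have e1 := E_pos (show (0 : ℝ) ≤ 1 / 4 by norm_num)
  have e3 := E_pos (show (0 : ℝ) ≤ 3 / 4 by norm_num)
  have hsq : (E (1 / 4) * E (1 / 4) / (E (3 / 4) * E (3 / 4))) ^ 2 = 16 / 27 := by
    have : (E (1 / 4) * E (1 / 4) / (E (3 / 4) * E (3 / 4))) ^ 2 =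
        (E (1 / 4) ^ 2) ^ 2 / E (3 / 4) ^ 4 := by
      field_simp
    rw [this, h14, h34]
    norm_num
  rw [E₃, e, show (1 / 2 - 1 / 4 : ℝ) = 1 / 4 by norm_num,
    show (1 / 2 + 1 / 4 : ℝ) = 3 / 4 by norm_num, show (1 - 1 / 4 : ℝ) = 3 / 4 by norm_num,
    ← hsq, ← Real.rpow_natCast, ← Real.rpow_mul (by positivity)]
  congr 1
  push_cast
  ring

/-- Sharp bound for the convolution of weighted functions. -/
theorem l2_lconv_wt_le {a : ℝ} (ha : 0 < a) {u v : Space d → ℝ≥0∞} (hu : Measurable u)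
    (hv : Measurable v) (p q : ℝ) {l : ℝ} (h0 : 0 ≤ l) (h1 : l ≤ a) :
    l2 (lconv (fun k => wt p k * u k) (fun k => wt q k * v k)) ≤
      ENNReal.ofReal (E₃ l a d) * (∫⁻ k : Space d, wt (-(2 * a)) k) ^ (1 / 2 : ℝ) *
        l2 (fun k => wt (p + a - l) k * u k) * l2 (fun k => wt (q + l) k * v k) := by
  have hx0 : 0 ≤ l / (2 * a) := by positivity
  have hx1 : l / (2 * a) ≤ 1 / 2 := by rw [div_le_div_iff₀ (by positivity) two_pos]; linarith
  -- With `x = l / (2a)`, the power `R ^ (1/2 - x)` has order `-(a - l)` and `R ^ x` has order `-l`: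
  -- the `a` extra orders are shared between the factors.
  have key := l2_lconv_le (d := d) (R := wt (-(2 * a))) (measurable_wt _)
    (A := fun k => wt (p + a - l) k * u k) (B := fun k => wt (q + l) k * v k) (by fun_prop)
    (by fun_prop) hx0 hx1
  have e1 : ∀ k : Space d, wt (-(2 * a)) k ^ (1 / 2 - l / (2 * a)) * (wt (p + a - l) k * u k) =
      wt p k * u k := by
    intro k
    rw [wt_rpow, ← mul_assoc, ← wt_add]
    congr 2
    field_simp
    ring
  have e2 : ∀ k : Space d, wt (-(2 * a)) k ^ (l / (2 * a)) * (wt (q + l) k * v k) =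
      wt q k * v k := by
    intro k
    rw [wt_rpow, ← mul_assoc, ← wt_add]
    congr 2
    field_simp
    ring
  simp only [e1, e2] at key
  rwa [← ENNReal.ofReal_pow (rootE_pos hx0 hx1).le, ← E₃_eq_rootE_pow ha h0 h1] at key

/-! ### Expansion of the weight over the lattice -/

/-- At `n = 0` the quotient is `0` by convention; this does no harm, since only `j = 0` occurs in
the lattice then. -/
lemma plus_mul_div_plus {n : ℝ} (hn : 0 ≤ n) : n / plus n * plus n = n := by
  rcases hn.eq_or_lt with rfl | hn
  · simp
  · have : 0 < plus n := Nat.ceil_pos.2 hn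
    field_simp

/-- Expansion of the weight of a sum over the lattice of intermediate orders. -/
lemma wt_le_sum {n : ℝ} (hn : 0 ≤ n) (h k : Space d) :
    wt n k ≤ ∑ j ∈ Finset.range (plus n + 1), ((plus n).choose j : ℝ≥0∞) *
      (wt (j * (n / plus n)) h * wt (n - j * (n / plus n)) (k - h)) := by
  set s := n / plus n with hs
  have hsN := plus_mul_div_plus hn
  have hs0 : 0 ≤ s := by positivity
  have hs1 : s ≤ 1 := div_le_one_of_le₀ (Nat.le_ceil n) (by positivity)
  have htri : √(1 + ‖k‖ ^ 2) ≤ √(1 + ‖h‖ ^ 2) + √(1 + ‖k - h‖ ^ 2) := by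
    rw [Real.sqrt_le_iff]
    refine ⟨by positivity, ?_⟩
    have h1 : ‖k‖ ≤ ‖h‖ + ‖k - h‖ := by
      simpa using norm_add_le h (k - h)
    have h2 : ‖h‖ ≤ √(1 + ‖h‖ ^ 2) := Real.le_sqrt_of_sq_le (by linarith)
    have h3 : ‖k - h‖ ≤ √(1 + ‖k - h‖ ^ 2) := Real.le_sqrt_of_sq_le (by linarith)
    have h4 : ‖h‖ * ‖k - h‖ ≤ √(1 + ‖h‖ ^ 2) * √(1 + ‖k - h‖ ^ 2) := by gcongr
    have h5 := Real.sq_sqrt (show 0 ≤ 1 + ‖h‖ ^ 2 by positivity)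
    have h6 := Real.sq_sqrt (show 0 ≤ 1 + ‖k - h‖ ^ 2 by positivity)
    have h7 : ‖k‖ ^ 2 ≤ (‖h‖ + ‖k - h‖) ^ 2 := by gcongr
    nlinarith
  have hreal : √(1 + ‖k‖ ^ 2) ^ n ≤ ∑ j ∈ Finset.range (plus n + 1), ((plus n).choose j : ℝ) *
      (√(1 + ‖h‖ ^ 2) ^ (j * s) * √(1 + ‖k - h‖ ^ 2) ^ (n - j * s)) := by
    calc √(1 + ‖k‖ ^ 2) ^ n = (√(1 + ‖k‖ ^ 2) ^ s) ^ plus n := by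
          rw [← Real.rpow_mul_natCast (by positivity), hsN]
      -- Subadditivity of `t ↦ t ^ s` needs `s ≤ 1`, which is why `n` is rounded up.
      _ ≤ (√(1 + ‖h‖ ^ 2) ^ s + √(1 + ‖k - h‖ ^ 2) ^ s) ^ plus n := by
          gcongr
          refine (Real.rpow_le_rpow (by positivity) htri hs0).trans ?_
          exact Real.rpow_add_le_add_rpow (by positivity) (by positivity) hs0 hs1
      _ = _ := by
          rw [add_pow]
          refine Finset.sum_congr rfl fun j hj => ?_
          have hj : j ≤ plus n := by simpa [Nat.lt_succ_iff] using hj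
          rw [← Real.rpow_mul_natCast (by positivity), ← Real.rpow_mul_natCast (by positivity),
            Nat.cast_sub hj, mul_sub, hsN, mul_comm s]
          ring
  refine (ENNReal.ofReal_le_ofReal hreal).trans_eq ?_
  rw [ENNReal.ofReal_sum_of_nonneg fun j _ => by positivity]
  refine Finset.sum_congr rfl fun j _ => ?_
  rw [wt, wt, ENNReal.ofReal_mul (by positivity), ENNReal.ofReal_natCast,
    ENNReal.ofReal_mul (by positivity)]

/-- A bound for the terms of the lattice expansion yields a bound for a convolution. -/
lemma l2_wt_mul_lconv_le {n : ℝ} (hn : 0 ≤ n) {u v : Space d → ℝ≥0∞} (hu : Measurable u)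
    (hv : Measurable v) {e : ℝ → ℝ} (M : ℝ≥0∞)
    (he : ∀ j ≤ plus n, 0 ≤ e (j * (n / plus n)))
    (hM : ∀ j ≤ plus n, l2 (lconv (fun k => wt (j * (n / plus n)) k * u k)
      (fun k => wt (n - j * (n / plus n)) k * v k)) ≤ ENNReal.ofReal (e (j * (n / plus n))) * M) :
    l2 (fun k => wt n k * lconv u v k) ≤ ENNReal.ofReal (latticeSum n e) * M := by
  have hpt : ∀ k, wt n k * lconv u v k ≤ ∑ j ∈ Finset.range (plus n + 1),
      ((plus n).choose j : ℝ≥0∞) * lconv (fun k => wt (j * (n / plus n)) k * u k)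
        (fun k => wt (n - j * (n / plus n)) k * v k) k := by
    intro k
    simp only [lconv]
    rw [← lintegral_const_mul _ (by fun_prop)]
    have : ∀ j : ℕ, ((plus n).choose j : ℝ≥0∞) * ∫⁻ h, wt (j * (n / plus n)) h * u h *
        (wt (n - j * (n / plus n)) (k - h) * v (k - h)) = ∫⁻ h, ((plus n).choose j : ℝ≥0∞) *
        (wt (j * (n / plus n)) h * u h * (wt (n - j * (n / plus n)) (k - h) * v (k - h))) :=
      fun j => (lintegral_const_mul _ (by fun_prop)).symm
    simp only [this]
    rw [← lintegral_finsetSum _ (fun j _ => by fun_prop)]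
    refine lintegral_mono fun h => ?_
    refine (mul_le_mul_left (wt_le_sum hn h k) _).trans_eq ?_
    rw [Finset.sum_mul]
    refine Finset.sum_congr rfl fun j _ => ?_
    ring
  refine (l2_mono (Eventually.of_forall hpt)).trans ?_
  have hmeas : ∀ j : ℕ, Measurable (lconv (fun k => wt (j * (n / plus n)) k * u k)
      (fun k => wt (n - j * (n / plus n)) k * v k)) := fun j =>
    measurable_lconv (by fun_prop) (by fun_prop)
  refine (l2_sum_le _ fun j => (hmeas j).const_mul _).trans ?_
  rw [latticeSum, ENNReal.ofReal_sum_of_nonneg, Finset.sum_mul]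
  · refine Finset.sum_le_sum fun j hj => ?_
    have hj : j ≤ plus n := by simpa [Nat.lt_succ_iff] using hj
    rw [l2_const_mul _ (hmeas j), ENNReal.ofReal_mul (by positivity), ENNReal.ofReal_natCast,
      mul_assoc]
    exact mul_le_mul_right (hM j hj) _
  · intro j hj
    have hj : j ≤ plus n := by simpa [Nat.lt_succ_iff] using hj
    exact mul_nonneg (by positivity) (he j hj)

/-! ### Sobolev norms and the normalised transform -/

/-- The modulus of the normalised Fourier transform. -/
noncomputable def absFourier (f : L2 d) (k : Space d) : ℝ≥0∞ := ‖fourierL2 f k‖ₑ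

/-- The Sobolev norm as an element of `[0, ∞]`. -/
noncomputable def enormH (n : ℝ) (f : L2 d) : ℝ≥0∞ := l2 fun k => wt n k * absFourier f k

lemma stronglyMeasurable_fourierL2 (f : L2 d) : StronglyMeasurable (fourierL2 f) := by
  unfold fourierL2
  exact ((Lp.stronglyMeasurable (𝓕 f : L2 d)).comp_measurable (by fun_prop)).const_mul _

@[fun_prop]
lemma measurable_absFourier (f : L2 d) : Measurable (absFourier f) :=
  (stronglyMeasurable_fourierL2 f).enorm

lemma eLpNorm_weightedFourier (n : ℝ) (f : L2 d) :
    eLpNorm (weightedFourier n f) 2 volume = enormH n f := by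
  rw [eLpNorm_two_eq_l2, enormH]
  congr 1
  ext k
  rw [weightedFourier, enorm_mul, absFourier, wt, ← ofReal_norm, Complex.norm_real,
    Real.norm_of_nonneg (by positivity)]

lemma memH_iff {n : ℝ} {f : L2 d} : MemH n f ↔ enormH n f ≠ ⊤ := by
  rw [MemH, MemLp, eLpNorm_weightedFourier, lt_top_iff_ne_top]
  refine and_iff_right (StronglyMeasurable.aestronglyMeasurable ?_)
  have h : Continuous fun k : Space d => ((√(1 + ‖k‖ ^ 2) ^ n : ℝ) : ℂ) :=
    Complex.continuous_ofReal.comp (Continuous.rpow_const (by fun_prop)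
      fun k => Or.inl (sqrt_one_add_pos k).ne')
  exact h.stronglyMeasurable.mul (stronglyMeasurable_fourierL2 f)

lemma normH_eq (n : ℝ) (f : L2 d) : normH n f = (enormH n f).toReal := by
  rw [normH, eLpNorm_weightedFourier]

lemma enormH_mono {m n : ℝ} (h : m ≤ n) (f : L2 d) : enormH m f ≤ enormH n f :=
  l2_mono (Eventually.of_forall fun k => mul_le_mul_left (wt_mono h k) _)

/-- The normalising factor of the Fourier transform. -/
noncomputable def fc (d : ℕ) : ℝ≥0∞ := ENNReal.ofReal ((2 * Real.pi) ^ (-(d : ℝ) / 2))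

lemma fc_mul_fc : fc d * fc d * ENNReal.ofReal ((2 * Real.pi) ^ d) = 1 := by
  have : (0 : ℝ) < 2 * Real.pi := by positivity
  rw [fc, ← ENNReal.ofReal_mul (by positivity), ← ENNReal.ofReal_mul (by positivity),
    ← Real.rpow_natCast, ← Real.rpow_add this, ← Real.rpow_add this, ENNReal.ofReal_eq_one]
  ring_nf
  simp

lemma absFourier_eq (f : L2 d) (k : Space d) :
    absFourier f k = fc d * ‖(𝓕 f : L2 d) ((2 * Real.pi)⁻¹ • k)‖ₑ := by
  rw [absFourier, fourierL2, enorm_mul, fc, ← ofReal_norm, Complex.norm_real,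
    Real.norm_of_nonneg (by positivity)]

lemma lintegral_comp_inv_two_pi_smul {u : Space d → ℝ≥0∞} (hu : Measurable u) :
    ∫⁻ k, u ((2 * Real.pi)⁻¹ • k) = ENNReal.ofReal ((2 * Real.pi) ^ d) * ∫⁻ k, u k := by
  have hr : ((2 * Real.pi)⁻¹ : ℝ) ≠ 0 := by positivity
  have h := Measure.map_addHaar_smul (volume : Measure (Space d)) hr
  rw [finrank_euclideanSpace_fin, inv_pow, inv_inv, abs_of_pos (by positivity)] at h
  rw [← lintegral_map hu (measurable_const_smul _), h, lintegral_smul_measure, smul_eq_mul]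

/-- The two normalising factors cancel the Jacobian `(2π)^d` of the rescaling. The common factor `fc
d` matches the form of `absFourier_eq`. -/
lemma lconv_absFourier (f g : L2 d) (k : Space d) :
    fc d * lconv (absFourier f) (absFourier g) k =
      fc d * lconv (fun k => ‖(𝓕 f : L2 d) k‖ₑ) (fun k => ‖(𝓕 g : L2 d) k‖ₑ)
        ((2 * Real.pi)⁻¹ • k) := by
  have mF : Measurable fun k => ‖(𝓕 f : L2 d) k‖ₑ := (Lp.stronglyMeasurable _).enorm
  have mG : Measurable fun k => ‖(𝓕 g : L2 d) k‖ₑ := (Lp.stronglyMeasurable _).enorm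
  have h := lintegral_comp_inv_two_pi_smul (d := d) (u := fun y => ‖(𝓕 f : L2 d) y‖ₑ *
    ‖(𝓕 g : L2 d) ((2 * Real.pi)⁻¹ • k - y)‖ₑ) (mF.mul (mG.comp (measurable_const.sub measurable_id)))
  have hfc : fc d * fc d ≠ ⊤ := ENNReal.mul_ne_top ENNReal.ofReal_ne_top ENNReal.ofReal_ne_top
  have e : ∀ x : Space d, absFourier f x * absFourier g (k - x) = fc d * fc d *
      (‖(𝓕 f : L2 d) ((2 * Real.pi)⁻¹ • x)‖ₑ *
        ‖(𝓕 g : L2 d) ((2 * Real.pi)⁻¹ • k - (2 * Real.pi)⁻¹ • x)‖ₑ) := by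
    intro x
    rw [absFourier_eq, absFourier_eq, smul_sub]
    ring
  simp only [lconv, e]
  rw [lintegral_const_mul' _ _ hfc, h, ← mul_assoc (fc d * fc d), fc_mul_fc, one_mul]

/-- Cauchy–Schwarz: `wt (-a)` is square integrable because `a > d/2`, and it is paired with `wt a *
absFourier f`. -/
lemma integrable_fourier_of_memH {a : ℝ} (ha : (d : ℝ) / 2 < a) {f : L2 d} (hf : MemH a f) :
    Integrable (𝓕 f : L2 d) := by
  rw [memH_iff] at hf
  refine ⟨(Lp.stronglyMeasurable _).aestronglyMeasurable, ?_⟩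
  rw [hasFiniteIntegral_iff_enorm]
  have mF : Measurable fun k => ‖(𝓕 f : L2 d) k‖ₑ := (Lp.stronglyMeasurable _).enorm
  have h1 : ∫⁻ k, absFourier f k < ⊤ := by
    have h := lintegral_rpow_mul_le (d := d) (R := wt (-(2 * a)))
      (A := fun k => wt a k * absFourier f k) (measurable_wt _) (by fun_prop) (s := 1 / 2) (c := 1)
      (by norm_num) (by norm_num)
    have e : ∀ k : Space d, wt (-(2 * a)) k ^ (1 / 2 : ℝ) * (wt a k * absFourier f k) =
        absFourier f k := by
      intro k
      rw [wt_rpow, ← mul_assoc, ← wt_add, show -(2 * a) * (1 / 2) + a = 0 by ring]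
      simp [wt]
    simp only [e, ENNReal.rpow_one, div_one] at h
    refine h.trans_lt (ENNReal.mul_lt_top ?_ (lt_top_iff_ne_top.2 hf))
    rw [lintegral_wt ha]
    exact ENNReal.rpow_lt_top_of_nonneg (by norm_num) ENNReal.ofReal_ne_top
  simp only [absFourier_eq] at h1
  rw [lintegral_const_mul' (fc d) _ ENNReal.ofReal_ne_top,
    lintegral_comp_inv_two_pi_smul mF] at h1
  by_contra htop
  rw [not_lt, top_le_iff] at htop
  have : (0 : ℝ) < 2 * Real.pi := by positivity
  rw [htop, ENNReal.mul_top (by simpa using pow_pos this d), ENNReal.mul_top] at h1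
  · exact h1.ne rfl
  · rw [fc, ne_eq, ENNReal.ofReal_eq_zero, not_le]
    positivity

/-- Multiplication by a function in `H^a`, `a > d/2`, acts on `L²`, and Fourier transforms of
products are bounded by convolutions. -/
theorem exists_mul_absFourier_le {a : ℝ} (ha : (d : ℝ) / 2 < a) {f : L2 d} (hf : MemH a f)
    (g : L2 d) :
    ∃ h : L2 d, (∀ᵐ x, h x = f x * g x) ∧
      ∀ᵐ k, absFourier h k ≤ fc d * lconv (absFourier f) (absFourier g) k := by
  obtain ⟨h, hfg, hk⟩ := exists_mul_enorm_fourier_le (integrable_fourier_of_memH ha hf) g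
  refine ⟨h, hfg, ?_⟩
  have hr : ((2 * Real.pi)⁻¹ : ℝ) ≠ 0 := by positivity
  have hq : Measure.QuasiMeasurePreserving (fun k : Space d => (2 * Real.pi)⁻¹ • k) := by
    refine ⟨measurable_const_smul _, ?_⟩
    rw [Measure.map_addHaar_smul _ hr]
    exact Measure.smul_absolutelyContinuous
  filter_upwards [hq.ae hk] with k hk
  rw [lconv_absFourier, absFourier_eq]
  gcongr

/-- The Sobolev norm of a product is controlled by a bound for the terms of the lattice
expansion. -/
lemma enormH_mul_le {a n : ℝ} (ha : (d : ℝ) / 2 < a) (hn : 0 ≤ n) {f g h : L2 d}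
    (hh : ∀ᵐ k, absFourier h k ≤ fc d * lconv (absFourier f) (absFourier g) k) {e : ℝ → ℝ}
    (M : ℝ≥0∞) (he : ∀ j ≤ plus n, 0 ≤ e (j * (n / plus n)))
    (hM : ∀ j ≤ plus n, l2 (lconv (fun k => wt (j * (n / plus n)) k * absFourier f k)
      (fun k => wt (n - j * (n / plus n)) k * absFourier g k)) ≤
        ENNReal.ofReal (e (j * (n / plus n))) *
          ((∫⁻ k : Space d, wt (-(2 * a)) k) ^ (1 / 2 : ℝ) * M)) :
    enormH n h ≤ ENNReal.ofReal (S a d * latticeSum n e) * M := by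
  have key := l2_wt_mul_lconv_le hn (measurable_absFourier f) (measurable_absFourier g) _ he hM
  have h1 : enormH n h ≤
      l2 fun k => fc d * (wt n k * lconv (absFourier f) (absFourier g) k) := by
    refine l2_mono ?_
    filter_upwards [hh] with k hk
    calc wt n k * absFourier h k ≤ wt n k * (fc d * lconv (absFourier f) (absFourier g) k) := by
          gcongr
      _ = _ := by ring
  have hm := measurable_lconv (measurable_absFourier f) (measurable_absFourier g)
  rw [l2_const_mul _ (by fun_prop)] at h1
  calc enormH n h ≤ fc d * (ENNReal.ofReal (latticeSum n e) *
        ((∫⁻ k : Space d, wt (-(2 * a)) k) ^ (1 / 2 : ℝ) * M)) := h1.trans (by gcongr)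
    _ = fc d * (∫⁻ k : Space d, wt (-(2 * a)) k) ^ (1 / 2 : ℝ) *
        ENNReal.ofReal (latticeSum n e) * M := by ring
    _ = _ := by rw [fc, ofReal_S ha, ← ENNReal.ofReal_mul (S_pos ha).le]

/-! ### Product estimates for low and high orders -/

lemma lattice_nonneg {n : ℝ} (hn : 0 ≤ n) (j : ℕ) : 0 ≤ j * (n / plus n) := by positivity

lemma lattice_le {n : ℝ} (hn : 0 ≤ n) {j : ℕ} (hj : j ≤ plus n) : j * (n / plus n) ≤ n := by
  calc (j : ℝ) * (n / plus n) ≤ plus n * (n / plus n) := by gcongr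
    _ = n := by rw [mul_comm, plus_mul_div_plus hn]

/-- Sobolev product bound for low orders. -/
theorem enormH_mul_le_low {a n : ℝ} (ha : (d : ℝ) / 2 < a) (hn : 0 ≤ n) (hna : n ≤ a)
    {f g h : L2 d}
    (hh : ∀ᵐ k, absFourier h k ≤ fc d * lconv (absFourier f) (absFourier g) k) :
    enormH n h ≤ ENNReal.ofReal (S a d * latticeSum n fun l => lowOrderE n l a d) *
      (enormH a f * enormH n g) := by
  have ha0 : 0 < a := (show (0 : ℝ) ≤ d / 2 by positivity).trans_lt ha
  refine enormH_mul_le ha hn hh _ (fun j hj => E₃_nonneg ha0 (lattice_nonneg hn j)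
    ((lattice_le hn hj).trans hna)) fun j hj => ?_
  set l := j * (n / plus n)
  -- Taking the free parameter equal to `l` places order `a` on `f` and order `n` on `g`; it is
  -- admissible since `l ≤ n ≤ a`.
  have key := l2_lconv_wt_le ha0 (measurable_absFourier f) (measurable_absFourier g) l (n - l)
    (lattice_nonneg hn j) ((lattice_le hn hj).trans hna)
  rw [add_sub_cancel_left, sub_add_cancel] at key
  refine key.trans_eq ?_
  simp only [lowOrderE, enormH]
  ring

/-- Interpolation of Sobolev norms. -/
lemma enormH_interpolate {a n θ : ℝ} (h0 : 0 ≤ θ) (h1 : θ ≤ 1) (f : L2 d) :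
    enormH ((1 - θ) * a + θ * n) f ≤ enormH a f ^ (1 - θ) * enormH n f ^ θ := by
  have h := ENNReal.lintegral_mul_norm_pow_le (μ := volume)
    (f := fun k => (wt a k * absFourier f k) ^ (2 : ℝ))
    (g := fun k => (wt n k * absFourier f k) ^ (2 : ℝ)) (by fun_prop) (by fun_prop)
    (sub_nonneg.2 h1) h0 (by ring)
  have e : ∀ k, (wt ((1 - θ) * a + θ * n) k * absFourier f k) ^ (2 : ℝ) =
      ((wt a k * absFourier f k) ^ (2 : ℝ)) ^ (1 - θ) *
        ((wt n k * absFourier f k) ^ (2 : ℝ)) ^ θ := by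
    intro k
    rw [← ENNReal.rpow_mul, ← ENNReal.rpow_mul, mul_comm 2 (1 - θ), mul_comm 2 θ,
      ENNReal.rpow_mul, ENNReal.rpow_mul, ← ENNReal.mul_rpow_of_nonneg _ _ zero_le_two]
    congr 1
    rw [ENNReal.mul_rpow_of_nonneg _ _ (sub_nonneg.2 h1), ENNReal.mul_rpow_of_nonneg _ _ h0,
      wt_rpow, wt_rpow, wt_add, mul_comm a, mul_comm n]
    have : absFourier f k = absFourier f k ^ (1 - θ) * absFourier f k ^ θ := by
      rw [← ENNReal.rpow_add_of_nonneg _ _ (sub_nonneg.2 h1) h0]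
      simp
    nth_rewrite 1 [this]
    ring
  unfold enormH l2
  simp only [e]
  refine (ENNReal.rpow_le_rpow h (by norm_num)).trans_eq ?_
  rw [ENNReal.mul_rpow_of_nonneg _ _ (by norm_num), ← ENNReal.rpow_mul, ← ENNReal.rpow_mul,
    ← ENNReal.rpow_mul, ← ENNReal.rpow_mul, mul_comm (1 - θ), mul_comm θ]

/-- Product bound at intermediate orders. -/
lemma enormH_mul_enormH_le_max {a n s : ℝ} (has : a ≤ s) (hsn : s ≤ n) (f g : L2 d) :
    enormH s f * enormH (n + a - s) g ≤
      max (enormH a f * enormH n g) (enormH n f * enormH a g) := by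
  -- The complementary order `n + a - s` is the reversed convex combination, so the product is
  -- bounded by a weighted geometric mean of the two entries of the maximum.
  obtain ⟨θ, h0, h1, hs⟩ : ∃ θ : ℝ, 0 ≤ θ ∧ θ ≤ 1 ∧ s = (1 - θ) * a + θ * n := by
    rcases (has.trans hsn).eq_or_lt with rfl | hlt
    · exact ⟨0, le_rfl, zero_le_one, by linarith⟩
    · have hpos : 0 < n - a := sub_pos.2 hlt
      refine ⟨(s - a) / (n - a), div_nonneg (by linarith) hpos.le,
        div_le_one_of_le₀ (by linarith) hpos.le, ?_⟩
      field_simp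
      ring
  have hs' : n + a - s = (1 - θ) * n + θ * a := by rw [hs]; ring
  rw [hs', hs]
  refine (mul_le_mul' (enormH_interpolate h0 h1 f) (enormH_interpolate h0 h1 g)).trans ?_
  set M := max (enormH a f * enormH n g) (enormH n f * enormH a g)
  calc enormH a f ^ (1 - θ) * enormH n f ^ θ * (enormH n g ^ (1 - θ) * enormH a g ^ θ) =
        (enormH a f * enormH n g) ^ (1 - θ) * (enormH n f * enormH a g) ^ θ := by
        rw [ENNReal.mul_rpow_of_nonneg _ _ (sub_nonneg.2 h1), ENNReal.mul_rpow_of_nonneg _ _ h0]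
        ring
    _ ≤ M ^ (1 - θ) * M ^ θ := by
        gcongr
        · exact le_max_left _ _
        · exact le_max_right _ _
    _ = M := by
        rw [← ENNReal.rpow_add_of_nonneg _ _ (sub_nonneg.2 h1) h0]
        simp

lemma highOrderE_nonneg {n l a : ℝ} (ha : 0 < a) (h0 : 0 ≤ l) (h1 : l ≤ n) :
    0 ≤ highOrderE n l a d := by
  unfold highOrderE
  split_ifs
  · exact E₃_nonneg ha h0 (by linarith)
  · positivity
  · exact E₃_nonneg ha (by linarith) (by linarith)

/-- Sobolev product bound for high orders. -/
theorem enormH_mul_le_high {a n : ℝ} (ha : (d : ℝ) / 2 < a) (hna : a ≤ n) {f g h : L2 d}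
    (hh : ∀ᵐ k, absFourier h k ≤ fc d * lconv (absFourier f) (absFourier g) k) :
    enormH n h ≤ ENNReal.ofReal (S a d * latticeSum n fun l => highOrderE n l a d) *
      max (enormH a f * enormH n g) (enormH n f * enormH a g) := by
  have ha0 : 0 < a := (show (0 : ℝ) ≤ d / 2 by positivity).trans_lt ha
  have hn : 0 ≤ n := ha0.le.trans hna
  refine enormH_mul_le ha hn hh _ (fun j hj => highOrderE_nonneg ha0 (lattice_nonneg hn j)
    (lattice_le hn hj)) fun j hj => ?_
  have hl0 := lattice_nonneg hn j
  have hln := lattice_le hn hj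
  set l := j * (n / plus n)
  have key : ∀ m, 0 ≤ m → m ≤ a → enormH (l + a - m) f * enormH (n - l + m) g ≤
      max (enormH a f * enormH n g) (enormH n f * enormH a g) →
      l2 (lconv (fun k => wt l k * absFourier f k) (fun k => wt (n - l) k * absFourier g k)) ≤
        ENNReal.ofReal (E₃ m a d) * ((∫⁻ k : Space d, wt (-(2 * a)) k) ^ (1 / 2 : ℝ) *
          max (enormH a f * enormH n g) (enormH n f * enormH a g)) := by
    intro m hm0 hma hmax
    refine (l2_lconv_wt_le ha0 (measurable_absFourier f) (measurable_absFourier g) l (n - l)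
      hm0 hma).trans ?_
    rw [mul_assoc, mul_assoc]
    gcongr
    exact hmax
  unfold highOrderE
  -- Both orders stay in `[a, n]` when `l + a - n ≤ m ≤ l`. The three cases use `m = l`, `m = a/2`
  -- and `m = a - (n - l)`, the admissible values closest to `a/2`.
  split_ifs with h1 h2
  · refine key l hl0 (by linarith) ?_
    rw [add_sub_cancel_left, sub_add_cancel]
    exact le_max_left _ _
  · rw [← E₃_half ha0]
    refine key (a / 2) (by positivity) (by linarith) ?_
    have := enormH_mul_enormH_le_max (a := a) (n := n) (s := l + a - a / 2) (by linarith)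
      (by linarith) f g
    rwa [show n + a - (l + a - a / 2) = n - l + a / 2 by ring] at this
  · rw [← E₃_symm ha0]
    refine key (a - (n - l)) (by linarith) (by linarith) ?_
    rw [show l + a - (a - (n - l)) = n by ring, show n - l + (a - (n - l)) = a by ring]
    exact le_max_right _ _

/-! ### Explicit bounds for the lattice sum -/

/-- By convexity of `-log`, its secant slopes from the point `1` increase. Comparing them at `x ≤ 1
- x` and clearing denominators gives `x log x ≤ (1 - x) log (1 - x)`. -/
lemma E_le_E_one_sub {x : ℝ} (h0 : 0 ≤ x) (h1 : x ≤ 1 / 2) : E x ≤ E (1 - x) := by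
  rcases h0.eq_or_lt with rfl | h0
  · simp [E]
  have hy : 0 < 1 - x := by linarith
  have h := strictConcaveOn_log_Ioi.concaveOn.neg.secant_mono (a := 1) (x := x) (y := 1 - x)
    (Set.mem_Ioi.2 one_pos) (Set.mem_Ioi.2 h0) (Set.mem_Ioi.2 hy) (by linarith) (by linarith)
    (by linarith)
  rw [Pi.neg_apply, Pi.neg_apply, Pi.neg_apply, Real.log_one, neg_zero, sub_zero, sub_zero,
    show 1 - x - 1 = -x by ring, show x - 1 = -(1 - x) by ring, neg_div_neg_eq, neg_div_neg_eq,
    div_le_div_iff₀ hy h0] at h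
  rw [E, E, Real.rpow_def_of_pos h0, Real.rpow_def_of_pos hy]
  exact Real.exp_le_exp.2 h

/-- Compare `E x` with `E (1 - x)`, and `E (1/2 - x)` with `E (1/2 + x)`. -/
lemma E₃_le_one {l a : ℝ} (ha : 0 < a) (h0 : 0 ≤ l) (h1 : l ≤ a) : E₃ l a d ≤ 1 := by
  have hx0 : 0 ≤ l / (2 * a) := by positivity
  have hx1 : l / (2 * a) ≤ 1 / 2 := by rw [div_le_div_iff₀ (by positivity) two_pos]; linarith
  set x := l / (2 * a) with hx
  have e1 := E_pos hx0
  have e2 := E_pos (show 0 ≤ 1 / 2 - x by linarith)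
  have e3 := E_pos (show 0 ≤ 1 - x by linarith)
  have e4 := E_pos (show 0 ≤ 1 / 2 + x by linarith)
  have h2 := E_le_E_one_sub (x := 1 / 2 - x) (by linarith) (by linarith)
  rw [show 1 - (1 / 2 - x) = 1 / 2 + x by ring] at h2
  refine Real.rpow_le_one (by positivity) ?_ (by positivity)
  rw [div_le_one (by positivity), mul_comm (E (1 / 2 + x))]
  exact mul_le_mul (E_le_E_one_sub hx0 hx1) h2 e2.le e3.le

lemma midE_le_one : (16 / 27 : ℝ) ^ ((d : ℝ) / 4) ≤ 1 :=
  Real.rpow_le_one (by norm_num) (by norm_num) (by positivity)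

lemma highOrderE_le_one {n l a : ℝ} (ha : 0 < a) (h0 : 0 ≤ l) (h1 : l ≤ n) :
    highOrderE n l a d ≤ 1 := by
  unfold highOrderE
  split_ifs
  · exact E₃_le_one ha h0 (by linarith)
  · exact midE_le_one
  · exact E₃_le_one ha (by linarith) (by linarith)

lemma latticeSum_nonneg {n : ℝ} {e : ℝ → ℝ} (he : ∀ j ≤ plus n, 0 ≤ e (j * (n / plus n))) :
    0 ≤ latticeSum n e :=
  Finset.sum_nonneg fun j hj => mul_nonneg (by positivity)
    (he j (Nat.lt_succ_iff.1 (Finset.mem_range.1 hj)))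

lemma latticeSum_le_two_pow {n : ℝ} {e : ℝ → ℝ} (he : ∀ j ≤ plus n, e (j * (n / plus n)) ≤ 1) :
    latticeSum n e ≤ 2 ^ plus n := by
  calc latticeSum n e ≤ ∑ j ∈ Finset.range (plus n + 1), ((plus n).choose j : ℝ) * 1 := by
        refine Finset.sum_le_sum fun j hj => ?_
        exact mul_le_mul_of_nonneg_left (he j (Nat.lt_succ_iff.1 (Finset.mem_range.1 hj)))
          (by positivity)
    _ = 2 ^ plus n := by
        simp only [mul_one]
        exact_mod_cast Nat.sum_range_choose (plus n)

/-- Every `j`-subset extends to a `p`-subset. Summed over `j`, this bounds a binomial tail by its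
last term times a power of two. -/
lemma choose_le_choose_mul_choose {N p j : ℕ} (hj : j ≤ p) (hp : p ≤ N) :
    N.choose j ≤ N.choose p * p.choose j := by
  rw [Nat.choose_mul hj]
  exact Nat.le_mul_of_pos_right _ (Nat.choose_pos (by omega))

lemma sum_choose_le {N p : ℕ} (hp : p ≤ N) :
    ∑ j ∈ Finset.range (p + 1), N.choose j ≤ 2 ^ p * N.choose p := by
  calc ∑ j ∈ Finset.range (p + 1), N.choose j ≤
        ∑ j ∈ Finset.range (p + 1), N.choose p * p.choose j :=
        Finset.sum_le_sum fun j hj =>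
          choose_le_choose_mul_choose (Nat.lt_succ_iff.1 (Finset.mem_range.1 hj)) hp
    _ = 2 ^ p * N.choose p := by
        rw [← Finset.mul_sum, Nat.sum_range_choose, mul_comm]

lemma aSub_pos {n a : ℝ} (ha : 0 < a) (hn : a ≤ n) : 1 ≤ aSub n a := by
  have hn0 : 0 < n := ha.trans_le hn
  have : 0 < plus n := Nat.ceil_pos.2 hn0
  exact Nat.ceil_pos.2 (by positivity)

lemma aSub_le {n a : ℝ} (ha : 0 < a) (hn : a ≤ n) : aSub n a ≤ plus n := by
  have hn0 : 0 < n := ha.trans_le hn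
  refine Nat.ceil_le.2 ?_
  rw [div_mul_eq_mul_div, div_le_iff₀ hn0]
  gcongr
  linarith

lemma lt_aSub_of_lattice_lt {n a : ℝ} (ha : 0 < a) (hn : a ≤ n) {j : ℕ}
    (h : j * (n / plus n) < a / 2) : j < aSub n a := by
  have hn0 : 0 < n := ha.trans_le hn
  have hN : (0 : ℝ) < plus n := by exact_mod_cast Nat.ceil_pos.2 hn0
  refine Nat.lt_ceil.2 ?_
  rw [div_mul_eq_mul_div, lt_div_iff₀ hn0]
  rw [mul_div_assoc', div_lt_iff₀ hN] at h
  linarith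

lemma choose_aSub {n a : ℝ} (ha : 0 < a) (hn : a ≤ n) :
    (plus n).choose (plus n - aSub n a + 1) = (plus n).choose (aSub n a - 1) := by
  have h1 := aSub_pos ha hn
  have h2 := aSub_le ha hn
  rw [← Nat.choose_symm (show aSub n a - 1 ≤ plus n by omega)]
  congr 1
  omega

/-- The factor equals `c` except near the two ends, where it is at most one. The excess `1 - c` is
charged to `j < m` and to `N - j < m`, two tails equal by symmetry and each at most `2 ^ (m - 1) *
N.choose (m - 1)`. Dividing by `c * 2 ^ N` gives the correction in `u`. -/
lemma latticeSum_highOrderE_le {n a : ℝ} (ha : 0 < a) (hn : a ≤ n) :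
    latticeSum n (fun l => highOrderE n l a d) ≤
      (16 / 27 : ℝ) ^ ((d : ℝ) / 4) * u n a d * 2 ^ plus n := by
  have hn0 : 0 ≤ n := ha.le.trans hn
  have hm1 := aSub_pos ha hn
  have hm2 := aSub_le ha hn
  have hch := choose_aSub ha hn
  set N := plus n with hN
  set m := aSub n a with hm
  set c := (16 / 27 : ℝ) ^ ((d : ℝ) / 4) with hc
  have hc1 : c ≤ 1 := midE_le_one
  have hc0 : 0 < c := by positivity
  have hcinv : (27 / 16 : ℝ) ^ ((d : ℝ) / 4) = c⁻¹ := by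
    rw [hc, ← Real.inv_rpow (by norm_num)]
    norm_num
  have hterm : ∀ j ≤ N, highOrderE n (j * (n / N)) a d ≤
      c + (1 - c) * ((if j < m then 1 else 0) + (if N - j < m then 1 else 0)) := by
    intro j hj
    have h1 := highOrderE_le_one (d := d) ha (lattice_nonneg hn0 j) (lattice_le hn0 hj)
    have hi : ∀ P : Prop, [Decidable P] → (0 : ℝ) ≤ if P then 1 else 0 := fun P _ => by
      split_ifs <;> norm_num
    by_cases hl : j * (n / N) < a / 2
    · rw [if_pos (lt_aSub_of_lattice_lt ha hn hl)]
      nlinarith [hi (N - j < m)]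
    by_cases hr : j * (n / N) ≤ n - a / 2
    · have : highOrderE n (j * (n / N)) a d = c := by rw [highOrderE, if_neg hl, if_pos hr]
      rw [this]
      have := mul_nonneg (sub_nonneg.2 hc1) (add_nonneg (hi (j < m)) (hi (N - j < m)))
      linarith
    · have hsN : n / N * N = n := plus_mul_div_plus hn0
      have : ((N - j : ℕ) : ℝ) * (n / N) < a / 2 := by
        rw [Nat.cast_sub hj, sub_mul, mul_comm (N : ℝ), hsN]
        linarith
      rw [if_pos (lt_aSub_of_lattice_lt ha hn this)]
      nlinarith [hi (j < m)]
  have hA : ∑ j ∈ Finset.range (N + 1), (N.choose j : ℝ) * (if j < m then 1 else 0) ≤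
      2 ^ (m - 1) * N.choose (m - 1) := by
    have hfil : (Finset.range (N + 1)).filter (· < m) = Finset.range (m - 1 + 1) := by
      ext j
      simp only [Finset.mem_filter, Finset.mem_range]
      omega
    simp only [mul_ite, mul_one, mul_zero]
    rw [← Finset.sum_filter, hfil]
    exact_mod_cast sum_choose_le (show m - 1 ≤ N by omega)
  have hB : ∑ j ∈ Finset.range (N + 1), (N.choose j : ℝ) * (if N - j < m then 1 else 0) =
      ∑ j ∈ Finset.range (N + 1), (N.choose j : ℝ) * (if j < m then 1 else 0) := by
    rw [← Finset.sum_flip]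
    refine Finset.sum_congr rfl fun j hj => ?_
    have hj : j ≤ N := Nat.lt_succ_iff.1 (Finset.mem_range.1 hj)
    rw [Nat.choose_symm hj, Nat.sub_sub_self hj]
  have hsum : (∑ j ∈ Finset.range (N + 1), (N.choose j : ℝ)) = 2 ^ N := by
    exact_mod_cast Nat.sum_range_choose N
  calc latticeSum n (fun l => highOrderE n l a d) ≤ ∑ j ∈ Finset.range (N + 1),
        (N.choose j : ℝ) *
          (c + (1 - c) * ((if j < m then 1 else 0) + (if N - j < m then 1 else 0))) := by
        refine Finset.sum_le_sum fun j hj => ?_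
        exact mul_le_mul_of_nonneg_left (hterm j (Nat.lt_succ_iff.1 (Finset.mem_range.1 hj)))
          (by positivity)
    _ = c * 2 ^ N + (1 - c) *
        (∑ j ∈ Finset.range (N + 1), (N.choose j : ℝ) * (if j < m then 1 else 0) +
        ∑ j ∈ Finset.range (N + 1), (N.choose j : ℝ) * (if N - j < m then 1 else 0)) := by
        rw [← hsum, Finset.mul_sum, ← Finset.sum_add_distrib, Finset.mul_sum,
          ← Finset.sum_add_distrib]
        refine Finset.sum_congr rfl fun j _ => ?_
        ring
    _ ≤ c * 2 ^ N + (1 - c) *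
        (2 ^ (m - 1) * N.choose (m - 1) + 2 ^ (m - 1) * N.choose (m - 1)) := by
        rw [hB]
        have := sub_nonneg.2 hc1
        gcongr
    _ = c * u n a d * 2 ^ N := by
        rw [u, ← hN, ← hm, hch, hcinv]
        have h2 : (2 : ℝ) ^ N = 2 ^ (N - m) * (2 ^ (m - 1) * 2) := by
          rw [← pow_succ, ← pow_add]
          congr 1
          omega
        rw [h2]
        field_simp
        ring

/-- For `n ≥ 1` one has `n₊ / n ≤ 2`, so `a_n` stays below the fixed bound `⌈a⌉₊`. The binomial
coefficient thus grows at most polynomially in `n₊`, against an exponential denominator. -/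
theorem tendsto_u {a : ℝ} (ha : 0 < a) : Tendsto (fun n : ℝ => u n a d) atTop (𝓝 1) := by
  set q := (27 / 16 : ℝ) ^ ((d : ℝ) / 4) - 1 with hq
  have hq0 : 0 ≤ q := sub_nonneg.2 (Real.one_le_rpow (by norm_num) (by positivity))
  set M := ⌈a⌉₊
  have hplus : Tendsto plus atTop atTop := tendsto_nat_ceil_atTop
  have hlim := ((tendsto_pow_const_div_const_pow_of_one_lt M (one_lt_two (α := ℝ))).comp
    hplus).const_mul (q * 2 ^ M)
  rw [mul_zero] at hlim
  have hsmall : Tendsto (fun n : ℝ => u n a d - 1) atTop (𝓝 0) := by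
    refine squeeze_zero' ?_ ?_ hlim
    · refine Eventually.of_forall fun n => ?_
      rw [u, add_sub_cancel_left]
      positivity
    · filter_upwards [eventually_ge_atTop (max 1 a)] with n hn
      have hn1 : 1 ≤ n := (le_max_left _ _).trans hn
      have hna : a ≤ n := (le_max_right _ _).trans hn
      have hm1 := aSub_pos ha hna
      have hm2 := aSub_le ha hna
      have hN1 : 1 ≤ plus n := hm1.trans hm2
      have hmM : aSub n a ≤ M := by
        refine Nat.ceil_le.2 (le_trans ?_ (Nat.le_ceil a))
        have h1 : (plus n : ℝ) < n + 1 := Nat.ceil_lt_add_one (by linarith)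
        rw [div_mul_eq_mul_div, div_le_iff₀ (by linarith)]
        nlinarith
      have hch : ((plus n).choose (plus n - aSub n a + 1) : ℝ) ≤ (plus n : ℝ) ^ M := by
        rw [choose_aSub ha hna]
        have h1 : (plus n).choose (aSub n a - 1) ≤ plus n ^ (aSub n a - 1) := Nat.choose_le_pow _ _
        have h2 : plus n ^ (aSub n a - 1) ≤ plus n ^ M := Nat.pow_le_pow_right hN1 (by omega)
        exact_mod_cast h1.trans h2
      have hpow : (2 : ℝ) ^ plus n ≤ 2 ^ M * 2 ^ (plus n - aSub n a) := by
        rw [← pow_add]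
        exact pow_le_pow_right₀ one_le_two (by omega)
      rw [u, add_sub_cancel_left, ← hq, Function.comp_apply]
      calc q / 2 ^ (plus n - aSub n a) * ((plus n).choose (plus n - aSub n a + 1) : ℝ) ≤
            q / 2 ^ (plus n - aSub n a) * (plus n : ℝ) ^ M := by gcongr
        _ = q * (plus n : ℝ) ^ M * (1 / 2 ^ (plus n - aSub n a)) := by ring
        _ ≤ q * (plus n : ℝ) ^ M * (2 ^ M / 2 ^ plus n) := by
            refine mul_le_mul_of_nonneg_left ?_ (by positivity)
            rw [div_le_div_iff₀ (by positivity) (by positivity), one_mul]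
            exact hpow
        _ = _ := by ring
  simpa using hsmall.add_const 1

/-! ### Existence of the least constant and conclusion -/

/-- There is an element of all Sobolev spaces with nonzero norms. -/
lemma exists_memH_pos (d : ℕ) : ∃ f : L2 d, ∀ n : ℝ, MemH n f ∧ 0 < normH n f := by
  have hr : (0 : ℝ) < (2 * Real.pi)⁻¹ := by positivity
  -- The radius `1 / (2π)` makes the normalised transform a multiple of the indicator of the unit
  -- ball, on which every weight is bounded.
  set F : Space d → ℂ := (Metric.ball 0 (2 * Real.pi)⁻¹).indicator fun _ => 1 with hF
  have hF2 : MemLp F 2 := memLp_indicator_const _ measurableSet_ball _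
    (Or.inr measure_ball_lt_top.ne)
  refine ⟨𝓕⁻ (hF2.toLp F), fun n => ?_⟩
  set f : L2 d := 𝓕⁻ (hF2.toLp F) with hf
  have hfour : (𝓕 f : L2 d) = hF2.toLp F := FourierTransform.fourier_fourierInv_eq _
  have hq : Measure.QuasiMeasurePreserving (fun k : Space d => (2 * Real.pi)⁻¹ • k) := by
    refine ⟨measurable_const_smul _, ?_⟩
    rw [Measure.map_addHaar_smul _ hr.ne']
    exact Measure.smul_absolutelyContinuous
  have habs : ∀ᵐ k, absFourier f k =
      (Metric.ball (0 : Space d) 1).indicator (fun _ => fc d) k := by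
    filter_upwards [hq.ae hF2.coeFn_toLp] with k hk
    rw [absFourier_eq, hfour, hk, hF]
    have hiff : (2 * Real.pi)⁻¹ • k ∈ Metric.ball (0 : Space d) (2 * Real.pi)⁻¹ ↔
        k ∈ Metric.ball (0 : Space d) 1 := by
      rw [mem_ball_zero_iff, mem_ball_zero_iff, norm_smul, Real.norm_of_nonneg hr.le]
      exact mul_lt_iff_lt_one_right hr
    by_cases h : k ∈ Metric.ball (0 : Space d) 1
    · rw [Set.indicator_of_mem h, Set.indicator_of_mem (hiff.2 h)]
      simp
    · rw [Set.indicator_of_notMem h, Set.indicator_of_notMem (mt hiff.1 h)]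
      simp
  have hfin : enormH n f ≠ ⊤ := by
    set C : ℝ≥0∞ := ENNReal.ofReal (√2 ^ |n|) * fc d
    have hle : enormH n f ≤ l2 ((Metric.ball (0 : Space d) 1).indicator fun _ => C) := by
      refine l2_mono ?_
      filter_upwards [habs] with k hk
      rw [hk]
      by_cases h : k ∈ Metric.ball (0 : Space d) 1
      · rw [Set.indicator_of_mem h, Set.indicator_of_mem h]
        refine mul_le_mul_left ((wt_mono (le_abs_self n) k).trans ?_) _
        rw [mem_ball_zero_iff] at h
        refine ENNReal.ofReal_le_ofReal ?_
        gcongr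
        nlinarith [norm_nonneg k]
      · simp [Set.indicator_of_notMem h]
    refine ne_top_of_le_ne_top ?_ hle
    have hC : C ≠ ⊤ := ENNReal.mul_ne_top ENNReal.ofReal_ne_top ENNReal.ofReal_ne_top
    refine ENNReal.rpow_ne_top_of_nonneg (by norm_num) ?_
    have e : ∀ k, (Metric.ball (0 : Space d) 1).indicator (fun _ => C) k ^ (2 : ℝ) =
        (Metric.ball (0 : Space d) 1).indicator (fun _ => C ^ (2 : ℝ)) k := by
      intro k
      by_cases h : k ∈ Metric.ball (0 : Space d) 1
      · rw [Set.indicator_of_mem h, Set.indicator_of_mem h]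
      · rw [Set.indicator_of_notMem h, Set.indicator_of_notMem h]
        simp
    simp only [e]
    rw [lintegral_indicator_const measurableSet_ball]
    exact ENNReal.mul_ne_top (ENNReal.rpow_ne_top_of_nonneg zero_le_two hC)
      measure_ball_lt_top.ne
  refine ⟨memH_iff.2 hfin, ?_⟩
  rw [normH_eq]
  refine ENNReal.toReal_pos (fun h0 => ?_) hfin
  rw [enormH, l2, ENNReal.rpow_eq_zero_iff_of_pos (by norm_num),
    lintegral_eq_zero_iff (by fun_prop)] at h0
  have hball : volume (Metric.ball (0 : Space d) 1) = 0 := by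
    refine measure_mono_null (fun k hk => ?_) (ae_iff.1 (h0.and habs))
    rintro ⟨h1, h2⟩
    change (wt n k * absFourier f k) ^ (2 : ℝ) = 0 at h1
    rw [h2, Set.indicator_of_mem hk, ENNReal.rpow_eq_zero_iff_of_pos two_pos] at h1
    have hw : wt n k ≠ 0 := by
      rw [wt, ne_eq, ENNReal.ofReal_eq_zero, not_le]
      exact Real.rpow_pos_of_pos (sqrt_one_add_pos k) _
    have hc : fc d ≠ 0 := by
      rw [fc, ne_eq, ENNReal.ofReal_eq_zero, not_le]
      positivity
    exact mul_ne_zero hw hc h1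
  exact (Metric.measure_ball_pos volume (0 : Space d) one_pos).ne' hball

/-- The best constant in a product inequality exists as soon as some constant does. -/
lemma exists_isLeast_constants {n : ℝ} {P : L2 d → L2 d → Prop} {A : L2 d → L2 d → ℝ}
    (hA : ∀ f g, 0 ≤ A f g) {f₀ g₀ : L2 d} (hP₀ : P f₀ g₀) (hA₀ : 0 < A f₀ g₀) {s : Set ℝ}
    (hs : s = {K | ∀ f g : L2 d, P f g → ∃ h : L2 d, (∀ᵐ x, h x = f x * g x) ∧ MemH n h ∧
      normH n h ≤ K * A f g}) {K₀ : ℝ} (hK₀ : K₀ ∈ s) :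
    ∃ K, IsLeast s K ∧ K ≤ K₀ := by
  have hbdd : ∀ K ∈ s, 0 ≤ K := by
    intro K hK
    rw [hs] at hK
    obtain ⟨h, -, -, hle⟩ := hK f₀ g₀ hP₀
    -- A pair with `A f₀ g₀ > 0` is indispensable here: without one, arbitrarily negative constants
    -- could be admissible.
    exact nonneg_of_mul_nonneg_left ((ENNReal.toReal_nonneg).trans hle) hA₀
  have hBB : BddBelow s := ⟨0, fun K hK => hbdd K hK⟩
  refine ⟨sInf s, ⟨?_, fun K hK => csInf_le hBB hK⟩, csInf_le hBB hK₀⟩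
  rw [hs]
  intro f g hfg
  rw [hs] at hK₀
  obtain ⟨h, hh, hmem, hle⟩ := hK₀ f g hfg
  refine ⟨h, hh, hmem, ?_⟩
  rcases (hA f g).eq_or_lt with h0 | hpos
  · rw [← hs, ← h0, mul_zero]
    rwa [← h0, mul_zero] at hle
  · rw [← div_le_iff₀ hpos]
    refine le_csInf ⟨K₀, hK₀⟩ fun K hK => ?_
    obtain ⟨h', hh', -, hle'⟩ := hK f g hfg
    -- The product determines `h` almost everywhere, so one and the same `h` satisfies the
    -- inequality for every admissible `K`, hence for the infimum.
    have : h' = h := by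
      refine Lp.ext ?_
      filter_upwards [hh, hh'] with x h1 h2
      rw [h1, h2]
    rw [div_le_iff₀ hpos, ← this]
    exact hle'

lemma lowOrder_mem {a n : ℝ} (ha : (d : ℝ) / 2 < a) (hn : 0 ≤ n) (hna : n ≤ a) :
    S a d * latticeSum n (fun l => lowOrderE n l a d) ∈ lowOrderConstants d n a := by
  intro f g hf hg
  have ha0 : 0 < a := (show (0 : ℝ) ≤ d / 2 by positivity).trans_lt ha
  obtain ⟨h, hfg, hh⟩ := exists_mul_absFourier_le ha hf g
  have key := enormH_mul_le_low ha hn hna hh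
  rw [memH_iff] at hf hg
  have hfin := ENNReal.mul_ne_top (ENNReal.ofReal_ne_top (r := S a d *
    latticeSum n fun l => lowOrderE n l a d)) (ENNReal.mul_ne_top hf hg)
  refine ⟨h, hfg, memH_iff.2 (ne_top_of_le_ne_top hfin key), ?_⟩
  have hK : 0 ≤ S a d * latticeSum n (fun l => lowOrderE n l a d) :=
    mul_nonneg (S_pos ha).le (latticeSum_nonneg fun j hj =>
      E₃_nonneg ha0 (lattice_nonneg hn j) ((lattice_le hn hj).trans hna))
  have := ENNReal.toReal_mono hfin key
  rw [ENNReal.toReal_mul, ENNReal.toReal_mul, ENNReal.toReal_ofReal hK] at this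
  rwa [normH_eq, normH_eq, normH_eq, mul_assoc]

lemma highOrder_mem {a n : ℝ} (ha : (d : ℝ) / 2 < a) (hna : a ≤ n) :
    S a d * latticeSum n (fun l => highOrderE n l a d) ∈ highOrderConstants d n a := by
  intro f g hf hg
  have ha0 : 0 < a := (show (0 : ℝ) ≤ d / 2 by positivity).trans_lt ha
  have hn : 0 ≤ n := ha0.le.trans hna
  rw [memH_iff] at hf hg
  have hfa := ne_top_of_le_ne_top hf (enormH_mono hna f)
  have hga := ne_top_of_le_ne_top hg (enormH_mono hna g)
  obtain ⟨h, hfg, hh⟩ := exists_mul_absFourier_le ha (memH_iff.2 hfa) g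
  have key := enormH_mul_le_high ha hna hh
  have hfin := ENNReal.mul_ne_top (ENNReal.ofReal_ne_top (r := S a d *
    latticeSum n fun l => highOrderE n l a d)) (max_lt (ENNReal.mul_lt_top hfa.lt_top hg.lt_top)
      (ENNReal.mul_lt_top hf.lt_top hga.lt_top)).ne
  refine ⟨h, hfg, memH_iff.2 (ne_top_of_le_ne_top hfin key), ?_⟩
  have hK : 0 ≤ S a d * latticeSum n (fun l => highOrderE n l a d) :=
    mul_nonneg (S_pos ha).le (latticeSum_nonneg fun j hj =>
      highOrderE_nonneg ha0 (lattice_nonneg hn j) (lattice_le hn hj))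
  have := ENNReal.toReal_mono hfin key
  rw [ENNReal.toReal_mul, ENNReal.toReal_max (ENNReal.mul_ne_top hfa hg)
    (ENNReal.mul_ne_top hf hga), ENNReal.toReal_mul, ENNReal.toReal_mul,
    ENNReal.toReal_ofReal hK] at this
  rwa [normH_eq, normH_eq, normH_eq, normH_eq, normH_eq]

lemma normH_nonneg (n : ℝ) (f : L2 d) : 0 ≤ normH n f := ENNReal.toReal_nonneg

end SobolevProduct

open SobolevProduct in
theorem proposition2p1 (d : ℕ) (hd : 1 ≤ d) (a : ℝ) (ha : (d : ℝ) / 2 < a) :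
    (∀ n : ℝ, 0 ≤ n → n ≤ (d : ℝ) / 2 →
      ∃ K : ℝ, IsLeast (lowOrderConstants d n a) K ∧
        K ≤ S a d * latticeSum n (fun l => lowOrderE n l a d) ∧
        S a d * latticeSum n (fun l => lowOrderE n l a d) ≤ S a d * 2 ^ plus n ∧
        K ≤ S a d * 2 ^ plus n) ∧
    (∀ n : ℝ, a ≤ n →
      ∃ K : ℝ, IsLeast (highOrderConstants d n a) K ∧
        K ≤ S a d * latticeSum n (fun l => highOrderE n l a d) ∧
        S a d * latticeSum n (fun l => highOrderE n l a d) ≤ S a d * 2 ^ plus n ∧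
        K ≤ S a d * 2 ^ plus n ∧
        S a d * latticeSum n (fun l => highOrderE n l a d) ≤
          (16 / 27 : ℝ) ^ ((d : ℝ) / 4) * S a d * u n a d * 2 ^ plus n ∧
        K ≤ (16 / 27 : ℝ) ^ ((d : ℝ) / 4) * S a d * u n a d * 2 ^ plus n) ∧
    Tendsto (fun n : ℝ => u n a d) atTop (𝓝 1) := by
  have ha0 : 0 < a := (show (0 : ℝ) ≤ d / 2 by positivity).trans_lt ha
  obtain ⟨f₀, hf₀⟩ := exists_memH_pos d
  refine ⟨fun n hn hnd => ?_, fun n hna => ?_, tendsto_u ha0⟩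
  · have hna : n ≤ a := hnd.trans ha.le
    obtain ⟨K, hK, hle⟩ := exists_isLeast_constants (n := n)
      (P := fun f g => MemH a f ∧ MemH n g) (A := fun f g => normH a f * normH n g)
      (fun f g => mul_nonneg (normH_nonneg _ _) (normH_nonneg _ _)) ⟨(hf₀ a).1, (hf₀ n).1⟩
      (mul_pos (hf₀ a).2 (hf₀ n).2) (by simp only [lowOrderConstants, and_imp, mul_assoc])
      (lowOrder_mem ha hn hna)
    have h2 : S a d * latticeSum n (fun l => lowOrderE n l a d) ≤ S a d * 2 ^ plus n :=
      mul_le_mul_of_nonneg_left (latticeSum_le_two_pow fun j hj => E₃_le_one ha0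
        (lattice_nonneg hn j) ((lattice_le hn hj).trans hna)) (S_pos ha).le
    exact ⟨K, hK, hle, h2, hle.trans h2⟩
  · have hn : 0 ≤ n := ha0.le.trans hna
    obtain ⟨K, hK, hle⟩ := exists_isLeast_constants (n := n)
      (P := fun f g => MemH n f ∧ MemH n g)
      (A := fun f g => max (normH a f * normH n g) (normH n f * normH a g))
      (fun f g => le_max_of_le_left (mul_nonneg (normH_nonneg _ _) (normH_nonneg _ _)))
      ⟨(hf₀ n).1, (hf₀ n).1⟩ (lt_max_of_lt_left (mul_pos (hf₀ a).2 (hf₀ n).2))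
      (by simp only [highOrderConstants, and_imp]) (highOrder_mem ha hna)
    have h2 : S a d * latticeSum n (fun l => highOrderE n l a d) ≤ S a d * 2 ^ plus n :=
      mul_le_mul_of_nonneg_left (latticeSum_le_two_pow fun j hj => highOrderE_le_one ha0
        (lattice_nonneg hn j) (lattice_le hn hj)) (S_pos ha).le
    have h3 : S a d * latticeSum n (fun l => highOrderE n l a d) ≤
        (16 / 27 : ℝ) ^ ((d : ℝ) / 4) * S a d * u n a d * 2 ^ plus n := by
      refine (mul_le_mul_of_nonneg_left (latticeSum_highOrderE_le ha0 hna) (S_pos ha).le).trans_eq ?_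
      ring
    exact ⟨K, hK, hle, h2, hle.trans h2, h3, hle.trans h3⟩
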